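/- \textbf{Setting.} Let $G=(\mathcal V,\mathcal E)$ be a directed graph without self-loops on a finite set $\mathcal V$ of $n$ agents; $N_i^-=\{j:(j,i)\in\mathcal E\}$, $d_i^-=|N_i^-|$ and $d_{\max}=\max_{i}d_i^-$. Let $f\ge 0$ be an integer, let $\mathcal F\subseteq\mathcal V$ with $\phi=|\mathcal F|\le f$ be the set of (Byzantine) faulty agents, and $\mathcal N=\mathcal V\setminus\mathcal F$. For a set $\mathcal F'\subseteq \mathcal V$ with $|\mathcal F'|\le f$, a \emph{reduced graph for $\mathcal F'$} is a subgraph of $G$ obtained by removing all agents of $\mathcal F'$ with their edges and then removing at most $f$ further incoming edges at each remaining agent. The \emph{source component} of a directed graph is the set of vertices that have a directed path to every other vertex; the graph contains a source component if this set is non-empty. Let $\tau_b$ be the number of reduced graphs for $\mathcal F$. Assume throughout that for every $\mathcal F'\subseteq\mathcal V$ with $|\mathcal F'|\le f$ every reduced graph for $\mathcal F'$ contains a source component. Let $\mathcal X\subseteq\mathbb R$ be non-empty, closed and convex, let $P_{\mathcal X}$ be the projection onto $\mathcal X$, and let $L$ be a constant. Each agent $i$ has a cost function $h_i:\mathcal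 X\to\mathbb R$ that is convex and continuously differentiable with $L$-Lipschitz derivative satisfying $|h_i'|\le L$ on $\mathcal X$, and whose set of minimizers over $\mathcal X$ is non-empty and compact. Let $(\lambda[t])_{t\ge0}$ be real stepsizes with $\lambda[t]\ge\lambda[t+1]$ for all $t$, $\sum_t\lambda[t]=\infty$ and $\sum_t\lambda[t]^2<\infty$. \textbf{Algorithm 1.} Agent $i$ starts with a state $x_i[0]\in\mathbb R$ (if $x_i[0]\notin\mathcal X$, then $h_i'(x_i[0])$ below stands for an arbitrary real number). In iteration $t\ge1$ every non-faulty agent sends its state $x_i[t-1]$ along its outgoing edges, while a faulty agent sends arbitrary real values, possibly different ones to different receivers. From the $d_i^-$ values received, each non-faulty agent $i$ discards the $f$ smallest and the $f$ largest (ties broken arbitrarily); with $N_i^*[t]$ the senders of the remaining values $w_j[t-1]$, and $w_i[t-1]=x_i[t-1]$, it sets \[ x_i[t]=P_{\mathcal X}\Big[\tfrac{1}{d_i^-+1-2f}\sum_{j\in\{i\}\cup N_i^*[t]}w_j[t-1]-\lambda[t-1]\,h_i'(x_i[t-1])\Big]. \] \textbf{Theorem.} For $\beta\in\mathbb R$ and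 $\gamma\in\mathbb N$ let $\mathcal A(\beta,\gamma)$ be the set of functions $\sum_{i\in\mathcal N}\alpha_ih_i$ with $\alpha_i\ge0$, $\sum_{i\in\mathcal N}\alpha_i=1$ and $|\{i\in\mathcal N:\alpha_i\ge\beta\}|\ge\gamma$, and let $Y(\beta,\gamma)=\bigcup_{p\in\mathcal A(\beta,\gamma)}\arg\min_{x\in\mathcal X}p(x)$. If $\gamma\ge f+1$, the source component of every reduced graph for $\mathcal F$ has at least $\gamma$ elements, and \[ \beta\le\frac{1}{\big(2(d_{\max}+1-2f)\big)^{\tau_b(n-\phi)}}, \] then in every execution of Algorithm 1 (for all initial states and all behaviours of the faulty agents) $Y(\beta,\gamma)$ is non-empty, and for all $i,j\in\mathcal N$ \[ \lim_{t\to\infty}\inf_{y\in Y(\beta,\gamma)}|x_i[t]-y|=0,\qquad \lim_{t\to\infty}|x_i[t]-x_j[t]|=0. \] -/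

import Mathlib

open Filter Topology

namespace ByzOpt

/-- The set `N_i⁻` of incoming neighbours of the agent `i`. -/
noncomputable def inNbrs {V : Type*} [Fintype V] (G : Digraph V) (i : V) : Finset V :=
  open Classical in Finset.univ.filter fun j => G.Adj j i

/-- The incoming degree `d_i⁻`. -/
noncomputable def inDegree {V : Type*} [Fintype V] (G : Digraph V) (i : V) : ℕ :=
  (inNbrs G i).card

/-- `d_max`, the largest incoming degree of an agent. -/
noncomputable def maxInDegree {V : Type*} [Fintype V] (G : Digraph V) : ℕ :=
  Finset.univ.sup (inDegree G)

/-- `H` is a reduced graph of `G` for the set `F` of faulty agents: its agents are the non-faulty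
ones, and it arises from the subgraph of `G` induced on them by removing at most `f` incoming edges
at each agent. -/
def IsReducedGraph {V : Type*} (G : Digraph V) (f : ℕ) (F : Finset V)
    (H : Digraph {v : V // v ∉ F}) : Prop :=
  (∀ i j : {v : V // v ∉ F}, H.Adj i j → G.Adj i j) ∧
    ∀ j : {v : V // v ∉ F}, {i : {v : V // v ∉ F} | G.Adj i j ∧ ¬ H.Adj i j}.ncard ≤ f

/-- `τ_b`, the number of reduced graphs for the set `F` of faulty agents. -/
noncomputable def numReducedGraphs {V : Type*} (G : Digraph V) (f : ℕ) (F : Finset V) : ℕ :=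
  {H : Digraph {v : V // v ∉ F} | IsReducedGraph G f F H}.ncard

/-- The source component: the agents that have a directed path to every other agent. A graph is
said to contain a source component if this set is non-empty. -/
def sourceComponent {W : Type*} (H : Digraph W) : Set W :=
  {v | ∀ w, Relation.ReflTransGen H.Adj v w}

/-- The minimizers of `h` over `X`. -/
def argminOn (X : Set ℝ) (h : ℝ → ℝ) : Set ℝ :=
  {x | x ∈ X ∧ ∀ y ∈ X, h x ≤ h y}

/-- `h` is an admissible cost function on `X` with gradient `h'` and constant `L`. Only the values
of `h` and `h'` on `X` matter. -/
structure Admissible (X : Set ℝ) (L : ℝ) (h h' : ℝ → ℝ) : Prop where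
  convex : ConvexOn ℝ X h
  hasDeriv : ∀ x ∈ X, HasDerivWithinAt h (h' x) X x
  continuous_gradient : ContinuousOn h' X
  lipschitz_gradient : ∀ x ∈ X, ∀ y ∈ X, |h' x - h' y| ≤ L * |x - y|
  bounded_gradient : ∀ x ∈ X, |h' x| ≤ L
  argmin_nonempty : (argminOn X h).Nonempty
  argmin_compact : IsCompact (argminOn X h)

/-- The collection `A(β, γ)` of valid functions: convex combinations of the cost functions of the
non-faulty agents in which at least `γ` weights are at least `β`. -/
def validFunctions {V : Type*} [Fintype V] [DecidableEq V] (F : Finset V) (h : V → ℝ → ℝ)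
    (β : ℝ) (γ : ℕ) : Set (ℝ → ℝ) :=
  {p | ∃ α : V → ℝ, (∀ i ∈ Fᶜ, 0 ≤ α i) ∧ ∑ i ∈ Fᶜ, α i = 1 ∧
    γ ≤ {i : V | i ∈ Fᶜ ∧ β ≤ α i}.ncard ∧ p = fun x => ∑ i ∈ Fᶜ, α i * h i x}

/-- `Y(β, γ)`: the minimizers over `X` of the valid functions. -/
def optimalSet {V : Type*} [Fintype V] [DecidableEq V] (F : Finset V) (h : V → ℝ → ℝ)
    (X : Set ℝ) (β : ℝ) (γ : ℕ) : Set ℝ :=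
  ⋃ p ∈ validFunctions F h β γ, argminOn X p

/-- `z = P_X[u]`, the point of `X` nearest to `u`. -/
def IsProjection (X : Set ℝ) (u z : ℝ) : Prop :=
  z ∈ X ∧ ∀ y ∈ X, |z - u| ≤ |y - u|

/-- `K` consists of the senders in `N` that are left after discarding the senders of the `f`
smallest and of the `f` largest of the values `w`, ties being broken arbitrarily. -/
def IsTrimming {V : Type*} [DecidableEq V] (N : Finset V) (w : V → ℝ) (f : ℕ)
    (K : Finset V) : Prop :=
  ∃ S B : Finset V, S ⊆ N ∧ B ⊆ N ∧ Disjoint S B ∧ S.card = f ∧ B.card = f ∧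
    (∀ s ∈ S, ∀ k ∈ N \ S, w s ≤ w k) ∧ (∀ b ∈ B, ∀ k ∈ N \ B, w k ≤ w b) ∧
    K = N \ (S ∪ B)

/-- An execution of the algorithm with the set `F` of Byzantine agents: `x t i` is the state of
agent `i` after iteration `t` and `w t j i` the value that `i` receives from `j` in iteration
`t + 1`. Non-faulty senders transmit their state; what a faulty agent sends is arbitrary and may
differ from receiver to receiver. The states `x t i` of faulty agents are unconstrained. -/
structure IsExecution {V : Type*} [Fintype V] [DecidableEq V] (G : Digraph V) (f : ℕ)
    (F : Finset V) (X : Set ℝ) (h' : V → ℝ → ℝ) (stepsize : ℕ → ℝ)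
    (x : ℕ → V → ℝ) (w : ℕ → V → V → ℝ) : Prop where
  honest : ∀ t, ∀ j ∉ F, ∀ i ∉ F, G.Adj j i → w t j i = x t j
  update : ∀ t, ∀ i ∉ F, ∃ K : Finset V, IsTrimming (inNbrs G i) (fun j => w t j i) f K ∧
    IsProjection X
      (1 / ((inDegree G i : ℝ) + 1 - 2 * f) * (x t i + ∑ j ∈ K, w t j i)
        - stepsize t * h' i (x t i))
      (x (t + 1) i)

end ByzOpt

/-!
If the trimming discards exactly the faulty values on one side, the surviving values are honest;
otherwise each of them lies between honest values discarded on the two sides. Hence an update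
averages the states of the honest agents only, with weights bounded below along the edges of a
reduced graph. Among `τ_b (n - φ)`
consecutive iterations some reduced graph `H` occurs `n - φ` times, so in the product of their
averaging matrices the columns of the source component of `H` are at least `β`. One column bounded
away from zero contracts the spread of the states, which gives consensus.

Kolmogorov's absolute probabilities, weights `p t` with `p t = p (t + 1) * M t` for the averaging
matrices `M t`, inherit that lower bound on a source component, so `∑ i, p t i * h i` is a valid
function for every `t`. The averages of the states with respect to `p t` are preserved by the
averaging and perform a descent for these functions, up to the vanishing disagreement. The valid
weights form a compact connected set, so `Y(β, γ)` is an interval, and at a point to the right of it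
the derivatives of all valid functions are bounded below by the same positive constant: the averages
cannot stay there.
-/

namespace ByzOpt

open Matrix
open scoped BigOperators Pointwise

section AveragingMatrices

variable {W R : Type*} [Fintype W] [DecidableEq W]

/-- `M` is a row stochastic matrix whose diagonal entries are at least `a` and whose entries at the
edges of `H` are at least `a * κ`; the row of an agent collects the weights of the values it
receives, so an edge from `j` to `i` concerns the entry `M i j`. -/
structure IsAveraging [Semiring R] [PartialOrder R] [IsOrderedRing R] (a κ : R) (H : Digraph W)
    (M : Matrix W W R) : Prop where
  stochastic : M ∈ rowStochastic R W
  diag : ∀ i, a ≤ M i i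
  edge : ∀ ⦃i j⦄, H.Adj j i → a * κ ≤ M i j

/-- The product `M (t + s - 1) * ⋯ * M t` of `s` consecutive matrices, starting with `M t` on the
right. -/
def stepProduct [Semiring R] (M : ℕ → Matrix W W R) (t : ℕ) : ℕ → Matrix W W R
  | 0 => 1
  | s + 1 => M (t + s) * stepProduct M t s

lemma stepProduct_mem_rowStochastic [Semiring R] [PartialOrder R] [IsOrderedRing R]
    {M : ℕ → Matrix W W R} (hM : ∀ t, M t ∈ rowStochastic R W) (t s : ℕ) :
    stepProduct M t s ∈ rowStochastic R W := by
  induction s with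
  | zero => exact one_mem _
  | succ s ih => exact mul_mem (hM _) ih

end AveragingMatrices

section Reachability

variable {W : Type*} {H : Digraph W} {j : W}

/-- The vertices that can be reached from `j` along at most `k` edges of `H`. -/
def reachWithin (H : Digraph W) (j : W) : ℕ → Set W
  | 0 => {j}
  | k + 1 => reachWithin H j k ∪ {i | ∃ i' ∈ reachWithin H j k, H.Adj i' i}

lemma reachWithin_subset_succ (H : Digraph W) (j : W) (k : ℕ) :
    reachWithin H j k ⊆ reachWithin H j (k + 1) :=
  Set.subset_union_left

lemma self_mem_reachWithin (H : Digraph W) (j : W) (k : ℕ) : j ∈ reachWithin H j k := by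
  induction k with
  | zero => exact Set.mem_singleton j
  | succ k ih => exact reachWithin_subset_succ H j k ih

lemma reachWithin_eq_univ_of_succ_eq (hj : j ∈ sourceComponent H) {k : ℕ}
    (hk : reachWithin H j (k + 1) = reachWithin H j k) : reachWithin H j k = Set.univ := by
  refine Set.eq_univ_of_forall fun i => ?_
  induction hj i with
  | refl => exact self_mem_reachWithin H j k
  | tail _ hadj ih => exact hk ▸ Or.inr ⟨_, ih, hadj⟩

lemma reachWithin_eq_univ_or_lt_ncard [Finite W] (hj : j ∈ sourceComponent H) (k : ℕ) :
    reachWithin H j k = Set.univ ∨ k < (reachWithin H j k).ncard := by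
  induction k with
  | zero => right; simp [reachWithin]
  | succ k ih =>
    by_cases hk : reachWithin H j (k + 1) = reachWithin H j k
    · exact Or.inl (hk ▸ reachWithin_eq_univ_of_succ_eq hj hk)
    · have hss : reachWithin H j k ⊂ reachWithin H j (k + 1) :=
        (reachWithin_subset_succ H j k).ssubset_of_ne (Ne.symm hk)
      rcases ih with ih | ih
      · exact Or.inl (Set.univ_subset_iff.1 (ih ▸ hss.subset))
      · exact Or.inr ((Nat.succ_le_of_lt ih).trans_lt (Set.ncard_lt_ncard hss))

lemma reachWithin_card [Finite W] (hj : j ∈ sourceComponent H) :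
    reachWithin H j (Nat.card W) = Set.univ :=
  (reachWithin_eq_univ_or_lt_ncard hj _).resolve_right (Set.ncard_le_card _).not_gt

end Reachability

section LargeColumns

variable {W R : Type*} [Fintype W] [DecidableEq W]
  [CommSemiring R] [PartialOrder R] [IsOrderedRing R]
  {a κ : R} {M : ℕ → Matrix W W R} {Hs : ℕ → Digraph W}

lemma mul_le_stepProduct_succ (hM : ∀ t, M t ∈ rowStochastic R W) (t s : ℕ) (i l j : W) :
    M (t + s) i l * stepProduct M t s l j ≤ stepProduct M t (s + 1) i j := by
  rw [stepProduct, Matrix.mul_apply]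
  exact Finset.single_le_sum (f := fun l => M (t + s) i l * stepProduct M t s l j)
    (fun l _ => mul_nonneg (nonneg_of_mem_rowStochastic (hM _))
      (nonneg_of_mem_rowStochastic (stepProduct_mem_rowStochastic hM t s))) (Finset.mem_univ l)

/-- If `i` is reached from `j` in the first `k` of the steps that use `H`, it retains the weight of
`j` through its diagonal entries in all other steps. -/
lemma pow_le_stepProduct (hM : ∀ t, IsAveraging a κ (Hs t) (M t)) (ha : 0 ≤ a) (hκ : 0 ≤ κ)
    (hκ1 : κ ≤ 1) (H : Digraph W) [DecidableEq (Digraph W)] (t s k : ℕ) {i j : W}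
    (hi : i ∈ reachWithin H j k) (hk : k ≤ Nat.count (fun r => Hs (t + r) = H) s) :
    a ^ s * κ ^ k ≤ stepProduct M t s i j := by
  have hMs := fun t => (hM t).stochastic
  induction s generalizing k i with
  | zero =>
    obtain rfl : k = 0 := by simpa using hk
    obtain rfl : i = j := hi
    simp [stepProduct]
  | succ s ih =>
    have stay : ∀ k, i ∈ reachWithin H j k → k ≤ Nat.count (fun r => Hs (t + r) = H) s →
        a ^ (s + 1) * κ ^ k ≤ stepProduct M t (s + 1) i j := fun k hi hk =>
      calc a ^ (s + 1) * κ ^ k = a * (a ^ s * κ ^ k) := by ring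
        _ ≤ M (t + s) i i * stepProduct M t s i j :=
          mul_le_mul ((hM _).diag i) (ih k hi hk) (by positivity)
            (nonneg_of_mem_rowStochastic (hMs _))
        _ ≤ _ := mul_le_stepProduct_succ hMs t s i i j
    rw [Nat.count_succ] at hk
    split_ifs at hk with hH
    · rcases k with _ | k
      · exact stay 0 hi (Nat.zero_le _)
      · have hk' := Nat.le_of_succ_le_succ hk
        rcases hi with hi | ⟨i', hi', hadj⟩
        · calc a ^ (s + 1) * κ ^ (k + 1) ≤ a ^ (s + 1) * κ ^ k :=
              mul_le_mul_of_nonneg_left (pow_le_pow_of_le_one hκ hκ1 k.le_succ) (by positivity)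
            _ ≤ _ := stay k hi hk'
        · calc a ^ (s + 1) * κ ^ (k + 1) = (a * κ) * (a ^ s * κ ^ k) := by ring
            _ ≤ M (t + s) i i' * stepProduct M t s i' j :=
              mul_le_mul ((hM _).edge (hH ▸ hadj)) (ih k hi' hk') (by positivity)
                (nonneg_of_mem_rowStochastic (hMs _))
            _ ≤ _ := mul_le_stepProduct_succ hMs t s i i' j
    · exact stay k hi hk

/-- The bound for a window of `T.ncard * card W` steps: by pigeonhole, one of the graphs in `T` is
used in at least `card W` of them. -/
lemma exists_forall_mem_sourceComponent_le_stepProduct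
    (hM : ∀ t, IsAveraging a κ (Hs t) (M t)) (ha : 0 ≤ a) (hκ : 0 ≤ κ) (hκ1 : κ ≤ 1)
    {T : Set (Digraph W)} (hT : ∀ t, Hs t ∈ T) (t : ℕ) :
    ∃ H ∈ T, ∀ j ∈ sourceComponent H, ∀ i,
      a ^ (T.ncard * Fintype.card W) * κ ^ Fintype.card W ≤
        stepProduct M t (T.ncard * Fintype.card W) i j := by
  classical
  have := Fintype.ofFinite T
  have hT' : ∀ t, Hs t ∈ T.toFinset := fun t => Set.mem_toFinset.2 (hT t)
  obtain ⟨H, hH, hcard⟩ := Finset.exists_le_card_fiber_of_mul_le_card_of_maps_to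
    (s := Finset.range (T.ncard * Fintype.card W)) (t := T.toFinset) (f := fun r => Hs (t + r))
    (n := Fintype.card W) (fun r _ => hT' _) ⟨_, hT' 0⟩
    (by rw [Finset.card_range, Set.ncard_eq_toFinset_card'])
  refine ⟨H, Set.mem_toFinset.1 hH, fun j hj i => pow_le_stepProduct hM ha hκ hκ1 H t _ _ ?_ ?_⟩
  · rw [← Nat.card_eq_fintype_card, reachWithin_card hj]
    exact Set.mem_univ i
  · rwa [Nat.count_eq_card_filter_range]

end LargeColumns

section AbsoluteProbabilities

variable {W R : Type*} [Fintype W] [CommSemiring R] [PartialOrder R]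
  {M : ℕ → Matrix W W R} {p : ℕ → W → R}

/-- `p` is a sequence of absolute probabilities (in the sense of Kolmogorov) of `M`: probability
vectors with `p t = p (t + 1) * M t`. Along the averaging steps `x (t + 1) = M t * x t` the average
of the states `x t` with respect to `p t` does not change. -/
structure IsAbsoluteProbability (M : ℕ → Matrix W W R) (p : ℕ → W → R) : Prop where
  mem_stdSimplex : ∀ t, p t ∈ stdSimplex R W
  eq_vecMul : ∀ t, p t = p (t + 1) ᵥ* M t

namespace IsAbsoluteProbability

lemma eq_vecMul_stepProduct [DecidableEq W] (hp : IsAbsoluteProbability M p) (t s : ℕ) :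
    p t = p (t + s) ᵥ* stepProduct M t s := by
  induction s with
  | zero => simp [stepProduct]
  | succ s ih => rw [ih, stepProduct, ← Matrix.vecMul_vecMul, ← add_assoc, ← hp.eq_vecMul]

lemma le_apply [IsOrderedRing R] [DecidableEq W] (hp : IsAbsoluteProbability M p)
    {t s : ℕ} {δ : R} {j : W} (hj : ∀ i, δ ≤ stepProduct M t s i j) : δ ≤ p t j := by
  rw [hp.eq_vecMul_stepProduct t s]
  calc δ = ∑ i, p (t + s) i * δ := by rw [← Finset.sum_mul, (hp.mem_stdSimplex _).2, one_mul]
    _ ≤ ∑ i, p (t + s) i * stepProduct M t s i j :=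
      Finset.sum_le_sum fun i _ =>
        mul_le_mul_of_nonneg_left (hj i) ((hp.mem_stdSimplex _).1 i)

lemma dotProduct_mulVec (hp : IsAbsoluteProbability M p) (t : ℕ) (x : W → R) :
    p (t + 1) ⬝ᵥ M t *ᵥ x = p t ⬝ᵥ x := by
  rw [Matrix.dotProduct_mulVec, ← hp.eq_vecMul]

end IsAbsoluteProbability

lemma vecMul_mem_stdSimplex [IsOrderedRing R] [DecidableEq W] {P : Matrix W W R}
    (hP : P ∈ rowStochastic R W) {q : W → R} (hq : q ∈ stdSimplex R W) :
    q ᵥ* P ∈ stdSimplex R W := by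
  have hsum := vecMul_dotProduct_one_eq_one_rowStochastic hP (x := q)
    (by simpa [dotProduct] using hq.2)
  exact ⟨nonneg_vecMul_of_mem_rowStochastic hP hq.1, by simpa [dotProduct] using hsum⟩

lemma exists_absoluteProbability_upTo [IsOrderedRing R] [DecidableEq W] [Nonempty W]
    (hM : ∀ t, M t ∈ rowStochastic R W) (T : ℕ) :
    ∃ p : ℕ → W → R, (∀ t, p t ∈ stdSimplex R W) ∧ ∀ t < T, p t = p (t + 1) ᵥ* M t := by
  induction T generalizing M with
  | zero => exact ⟨fun _ => Pi.single (Classical.arbitrary W) 1,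
      fun _ => single_mem_stdSimplex R _, by simp⟩
  | succ T ih =>
    obtain ⟨p, hp, hpM⟩ := ih fun t => hM (t + 1)
    refine ⟨fun | 0 => p 0 ᵥ* M 0 | t + 1 => p t, ?_, ?_⟩
    · rintro (_ | t)
      exacts [vecMul_mem_stdSimplex (hM 0) (hp 0), hp t]
    · rintro (_ | t) ht
      exacts [rfl, hpM t (Nat.lt_of_succ_lt_succ ht)]

lemma exists_isAbsoluteProbability [DecidableEq W] [Nonempty W] {M : ℕ → Matrix W W ℝ}
    (hM : ∀ t, M t ∈ rowStochastic ℝ W) : ∃ p, IsAbsoluteProbability M p := by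
  let simplices : Set (ℕ → W → ℝ) := Set.univ.pi fun _ => stdSimplex ℝ W
  let solutions : ℕ → Set (ℕ → W → ℝ) := fun T =>
    simplices ∩ {p | ∀ t < T, p t = p (t + 1) ᵥ* M t}
  have hcompact : IsCompact simplices := isCompact_univ_pi fun _ => isCompact_stdSimplex ℝ W
  have hclosed : ∀ T, IsClosed (solutions T) := by
    intro T
    refine hcompact.isClosed.inter ?_
    simp only [Set.ofPred_forall]
    refine isClosed_iInter fun t => isClosed_iInter fun _ => isClosed_eq (by fun_prop) ?_
    exact Continuous.matrix_vecMul (by fun_prop) continuous_const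
  obtain ⟨p, hp⟩ := IsCompact.nonempty_iInter_of_sequence_nonempty_isCompact_isClosed solutions
    (fun T p hp => ⟨hp.1, fun t ht => hp.2 t (ht.trans T.lt_succ_self)⟩)
    (fun T => (exists_absoluteProbability_upTo hM T).imp fun p hp => ⟨fun t _ => hp.1 t, hp.2⟩)
    (hcompact.of_isClosed_subset (hclosed 0) Set.inter_subset_left) hclosed
  rw [Set.mem_iInter] at hp
  exact ⟨p, fun t => (hp 0).1 t (Set.mem_univ t), fun t => (hp (t + 1)).2 t t.lt_succ_self⟩

end AbsoluteProbabilities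

section Contraction

lemma tendsto_zero_of_le_mul_add {u b : ℕ → ℝ} {ρ : ℝ} (hρ0 : 0 ≤ ρ) (hρ1 : ρ < 1)
    (hu : ∀ k, 0 ≤ u k) (hub : ∀ k, u (k + 1) ≤ ρ * u k + b k) (hb : Tendsto b atTop (𝓝 0)) :
    Tendsto u atTop (𝓝 0) := by
  rw [Metric.tendsto_atTop]
  intro ε hε
  have hpos : 0 < ε / 2 * (1 - ρ) := mul_pos (half_pos hε) (sub_pos.2 hρ1)
  obtain ⟨T, hT⟩ := eventually_atTop.1 (hb.eventually_lt_const hpos)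
  have hgeom : ∀ k, u (T + k) ≤ ε / 2 + ρ ^ k * u T := by
    intro k
    induction k with
    | zero => simpa using (half_pos hε).le
    | succ k ih =>
      calc u (T + k + 1) ≤ ρ * u (T + k) + b (T + k) := hub _
        _ ≤ ρ * (ε / 2 + ρ ^ k * u T) + ε / 2 * (1 - ρ) := by
          gcongr
          exact (hT _ (Nat.le_add_right T k)).le
        _ = ε / 2 + ρ ^ (k + 1) * u T := by ring
  have hlim : Tendsto (fun k => ρ ^ k * u T) atTop (𝓝 0) := by
    simpa using (tendsto_pow_atTop_nhds_zero_of_lt_one hρ0 hρ1).mul_const (u T)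
  obtain ⟨k₀, hk₀⟩ := eventually_atTop.1 (hlim.eventually_lt_const (half_pos hε))
  refine ⟨T + k₀, fun n hn => ?_⟩
  obtain ⟨k, rfl⟩ := Nat.exists_eq_add_of_le ((Nat.le_add_right T k₀).trans hn)
  rw [Real.dist_eq, sub_zero, abs_of_nonneg (hu _)]
  linarith [hgeom k, hk₀ k (by omega)]

/-- The sums of `u` over the consecutive windows of length `ν` contract in every step. -/
lemma tendsto_zero_of_window_le_mul_add {u b : ℕ → ℝ} {ρ : ℝ} {ν : ℕ} (hν : ν ≠ 0) (hρ0 : 0 ≤ ρ)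
    (hρ1 : ρ < 1) (hu : ∀ t, 0 ≤ u t) (hub : ∀ t, u (t + ν) ≤ ρ * u t + b t)
    (hb : Tendsto b atTop (𝓝 0)) : Tendsto u atTop (𝓝 0) := by
  let windowSum (v : ℕ → ℝ) (k : ℕ) : ℝ := ∑ r ∈ Finset.range ν, v (k * ν + r)
  have hb' : Tendsto (windowSum b) atTop (𝓝 0) := by
    have hindex : ∀ r, Tendsto (fun k => k * ν + r) atTop atTop := fun r =>
      tendsto_atTop_mono
        (fun k => (Nat.le_mul_of_pos_right k (Nat.pos_of_ne_zero hν)).trans (Nat.le_add_right _ r))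
        tendsto_id
    simpa only [windowSum, Function.comp_def, Finset.sum_const_zero] using
      tendsto_finsetSum (Finset.range ν) fun r _ => hb.comp (hindex r)
  have hwindow : Tendsto (windowSum u) atTop (𝓝 0) := by
    refine tendsto_zero_of_le_mul_add hρ0 hρ1 (fun k => Finset.sum_nonneg fun r _ => hu _)
      (fun k => ?_) hb'
    simp only [windowSum, Finset.mul_sum, ← Finset.sum_add_distrib]
    refine Finset.sum_le_sum fun r _ => ?_
    rw [add_one_mul, add_right_comm]
    exact hub _
  refine squeeze_zero hu (fun t => ?_) (hwindow.comp (Nat.tendsto_div_const_atTop hν))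
  calc u t = u (t / ν * ν + t % ν) := by rw [Nat.div_add_mod']
    _ ≤ windowSum u (t / ν) :=
      Finset.single_le_sum (f := fun r => u (t / ν * ν + r)) (fun r _ => hu _)
        (Finset.mem_range.2 (Nat.mod_lt t (Nat.pos_of_ne_zero hν)))

end Contraction

section Spread

variable {W : Type*} [Finite W]

/-- The spread `max y - min y` of finitely many real numbers. -/
noncomputable def spread (y : W → ℝ) : ℝ :=
  (⨆ i, y i) - ⨅ i, y i

lemma le_iSup_of_finite (y : W → ℝ) (i : W) : y i ≤ ⨆ i, y i :=
  le_ciSup (Set.finite_range y).bddAbove i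

lemma iInf_le_of_finite (y : W → ℝ) (i : W) : ⨅ i, y i ≤ y i :=
  ciInf_le (Set.finite_range y).bddBelow i

lemma abs_sub_le_spread (y : W → ℝ) (i k : W) : |y i - y k| ≤ spread y :=
  abs_sub_le_of_le_of_le (iInf_le_of_finite y i) (le_iSup_of_finite y i)
    (iInf_le_of_finite y k) (le_iSup_of_finite y k)

lemma spread_le [Nonempty W] {y : W → ℝ} {c : ℝ} (h : ∀ i k, y i - y k ≤ c) : spread y ≤ c := by
  obtain ⟨i, hi⟩ := exists_eq_ciSup_of_finite (f := y)
  obtain ⟨k, hk⟩ := exists_eq_ciInf_of_finite (f := y)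
  rw [spread, ← hi, ← hk]
  exact h i k

lemma spread_le_of_abs_sub_le [Nonempty W] {x y : W → ℝ} {c : ℝ} (h : ∀ i, |x i - y i| ≤ c) :
    spread x ≤ spread y + 2 * c :=
  spread_le fun i k => by
    linarith [(abs_le.1 (h i)).2, (abs_le.1 (h k)).1, (abs_le.1 (abs_sub_le_spread y i k)).2]

end Spread

section Consensus

variable {W : Type*} [Fintype W] [DecidableEq W]

lemma mulVec_mono {P : Matrix W W ℝ} (hP : P ∈ rowStochastic ℝ W) {y z : W → ℝ} (hyz : y ≤ z) :
    P *ᵥ y ≤ P *ᵥ z := fun i =>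
  Finset.sum_le_sum fun l _ => mul_le_mul_of_nonneg_left (hyz l) (hP.1 i l)

lemma mulVec_const {P : Matrix W W ℝ} (hP : P ∈ rowStochastic ℝ W) (c : ℝ) :
    (P *ᵥ fun _ => c) = fun _ => c := by
  ext i
  simp [Matrix.mulVec, dotProduct, ← Finset.sum_mul, sum_row_of_mem_rowStochastic hP]

lemma abs_mulVec_le {P : Matrix W W ℝ} (hP : P ∈ rowStochastic ℝ W) {y : W → ℝ} {c : ℝ}
    (hy : ∀ i, |y i| ≤ c) (i : W) : |(P *ᵥ y) i| ≤ c := by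
  have hlower := mulVec_mono hP (y := fun _ => -c) (fun i => (abs_le.1 (hy i)).1) i
  have hupper := mulVec_mono hP (z := fun _ => c) (fun i => (abs_le.1 (hy i)).2) i
  rw [mulVec_const hP] at hlower hupper
  exact abs_le.2 ⟨hlower, hupper⟩

lemma mulVec_le_of_column {P : Matrix W W ℝ} (hP : P ∈ rowStochastic ℝ W) {δ : ℝ} {j : W}
    (hj : ∀ i, δ ≤ P i j) {y : W → ℝ} {c : ℝ} (hy : ∀ i, y i ≤ c) (i : W) :
    (P *ᵥ y) i ≤ δ * y j + (1 - δ) * c := by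
  have hsum : c - (P *ᵥ y) i = ∑ l, P i l * (c - y l) := by
    simp [Matrix.mulVec, dotProduct, mul_sub, ← Finset.sum_mul, sum_row_of_mem_rowStochastic hP]
  have hterm : P i j * (c - y j) ≤ ∑ l, P i l * (c - y l) :=
    Finset.single_le_sum (f := fun l => P i l * (c - y l))
      (fun l _ => mul_nonneg (hP.1 _ _) (sub_nonneg.2 (hy l))) (Finset.mem_univ j)
  linarith [mul_le_mul_of_nonneg_right (hj i) (sub_nonneg.2 (hy j))]

lemma le_mulVec_of_column {P : Matrix W W ℝ} (hP : P ∈ rowStochastic ℝ W) {δ : ℝ} {j : W}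
    (hj : ∀ i, δ ≤ P i j) {y : W → ℝ} {c : ℝ} (hy : ∀ i, c ≤ y i) (i : W) :
    δ * y j + (1 - δ) * c ≤ (P *ᵥ y) i := by
  have h := mulVec_le_of_column hP hj (y := -y) (c := -c) (fun i => neg_le_neg (hy i)) i
  simp only [Matrix.mulVec_neg, Pi.neg_apply] at h
  linarith

lemma spread_mulVec_le [Nonempty W] {P : Matrix W W ℝ} (hP : P ∈ rowStochastic ℝ W) {δ : ℝ}
    {j : W} (hj : ∀ i, δ ≤ P i j) (y : W → ℝ) : spread (P *ᵥ y) ≤ (1 - δ) * spread y :=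
  spread_le fun i k => by
    have hi := mulVec_le_of_column hP hj (le_iSup_of_finite y) i
    have hk := le_mulVec_of_column hP hj (iInf_le_of_finite y) k
    rw [spread, mul_sub]
    linarith

lemma abs_sub_stepProduct_mulVec_le {M : ℕ → Matrix W W ℝ} (hM : ∀ t, M t ∈ rowStochastic ℝ W)
    {x : ℕ → W → ℝ} {η : ℕ → ℝ} (hx : ∀ t i, |x (t + 1) i - (M t *ᵥ x t) i| ≤ η t) (t s : ℕ)
    (i : W) : |x (t + s) i - (stepProduct M t s *ᵥ x t) i| ≤ ∑ r ∈ Finset.range s, η (t + r) := by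
  induction s generalizing i with
  | zero => simp [stepProduct]
  | succ s ih =>
    have hstep := abs_mulVec_le (hM (t + s)) (y := x (t + s) - stepProduct M t s *ᵥ x t) ih i
    rw [Matrix.mulVec_sub, Pi.sub_apply] at hstep
    rw [Finset.sum_range_succ, stepProduct, ← Matrix.mulVec_mulVec, add_comm (Finset.sum _ _)]
    exact (abs_sub_le _ ((M (t + s) *ᵥ x (t + s)) i) _).trans (add_le_add (hx (t + s) i) hstep)

lemma tendsto_abs_sub_of_column [Nonempty W] {M : ℕ → Matrix W W ℝ}
    (hM : ∀ t, M t ∈ rowStochastic ℝ W) {x : ℕ → W → ℝ} {η : ℕ → ℝ}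
    (hx : ∀ t i, |x (t + 1) i - (M t *ᵥ x t) i| ≤ η t) (hη : Tendsto η atTop (𝓝 0)) {ν : ℕ}
    (hν : ν ≠ 0) {δ : ℝ} (hδ : 0 < δ) (hcol : ∀ t, ∃ j, ∀ i, δ ≤ stepProduct M t ν i j) (i k : W) :
    Tendsto (fun t => |x t i - x t k|) atTop (𝓝 0) := by
  have hP := fun t => stepProduct_mem_rowStochastic hM t ν
  have hδ1 : δ ≤ 1 := by
    obtain ⟨j, hj⟩ := hcol 0
    exact (hj j).trans (le_one_of_mem_rowStochastic (hP 0))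
  have herr : Tendsto (fun t => 2 * ∑ r ∈ Finset.range ν, η (t + r)) atTop (𝓝 0) := by
    simpa using (tendsto_finsetSum (Finset.range ν) fun r _ =>
      hη.comp (tendsto_add_atTop_nat r)).const_mul 2
  have hspread : Tendsto (fun t => spread (x t)) atTop (𝓝 0) := by
    refine tendsto_zero_of_window_le_mul_add hν (sub_nonneg.2 hδ1) (by linarith)
      (fun t => (abs_nonneg _).trans (abs_sub_le_spread (x t) i i)) (fun t => ?_) herr
    obtain ⟨j, hj⟩ := hcol t
    exact (spread_le_of_abs_sub_le (abs_sub_stepProduct_mulVec_le hM hx t ν)).trans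
      (by gcongr; exact spread_mulVec_le (hP t) hj (x t))
  exact squeeze_zero (fun t => abs_nonneg _) (fun t => abs_sub_le_spread (x t) i k) hspread

end Consensus

section Trimming

variable {V : Type*}

/-- The weights `c` express the sum of the values `w` at `K` by the values at `H` (the honest
senders), and all but at most `f` elements of `H` have a substantial weight. -/
structure IsHonestWeighting (H K : Finset V) (w : V → ℝ) (f : ℕ) (c : V → ℝ) : Prop where
  nonneg : ∀ j, 0 ≤ c j
  sum_mul_eq : ∑ j ∈ H, c j * w j = ∑ j ∈ K, w j
  sum_eq : ∑ j ∈ H, c j = K.card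
  exists_large : ∃ E : Finset V, E.card ≤ f ∧ ∀ j ∈ H, j ∉ E → (1 / 2) ^ (f + 1) ≤ c j

variable [DecidableEq V]

lemma isHonestWeighting_indicator {H K : Finset V} (w : V → ℝ) {f : ℕ} (hKH : K ⊆ H)
    (hcard : (H \ K).card ≤ f) :
    IsHonestWeighting H K w f fun j => if j ∈ K then 1 else 0 where
  nonneg j := by split_ifs <;> norm_num
  sum_mul_eq := by simp [Finset.inter_eq_right.2 hKH]
  sum_eq := by simp [Finset.inter_eq_right.2 hKH]
  exists_large := by
    refine ⟨H \ K, hcard, fun j hjH hj => ?_⟩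
    rw [if_pos (by simpa [hjH] using hj)]
    exact pow_le_one₀ (by norm_num) (by norm_num)

/-- Weights that give each element of `S` an equal share of `a`, each element of `B` an equal share
of `b`, and `1 / 2` to everything else. They are used when the values at `S` average to at most,
and those at `B` to at least, the surviving values. -/
noncomputable def sandwichWeights (S B : Finset V) (a b : ℝ) (j : V) : ℝ :=
  if j ∈ S then a / S.card else if j ∈ B then b / B.card else 1 / 2

lemma sum_sandwichWeights_mul {K S B : Finset V} (hKS : Disjoint K S) (hKB : Disjoint K B)
    (hSB : Disjoint S B) (a b : ℝ) (u : V → ℝ) :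
    ∑ j ∈ K ∪ (S ∪ B), sandwichWeights S B a b j * u j =
      1 / 2 * ∑ j ∈ K, u j + (a * 𝔼 j ∈ S, u j + b * 𝔼 j ∈ B, u j) := by
  have hK : ∑ j ∈ K, sandwichWeights S B a b j * u j = 1 / 2 * ∑ j ∈ K, u j := by
    rw [Finset.mul_sum]
    refine Finset.sum_congr rfl fun j hj => ?_
    rw [sandwichWeights, if_neg (Finset.disjoint_left.1 hKS hj),
      if_neg (Finset.disjoint_left.1 hKB hj)]
  have hS : ∑ j ∈ S, sandwichWeights S B a b j * u j = a * 𝔼 j ∈ S, u j := by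
    rw [Finset.expect_eq_sum_div_card, mul_div_left_comm, mul_comm, Finset.mul_sum]
    exact Finset.sum_congr rfl fun j hj => by rw [sandwichWeights, if_pos hj]
  have hB : ∑ j ∈ B, sandwichWeights S B a b j * u j = b * 𝔼 j ∈ B, u j := by
    rw [Finset.expect_eq_sum_div_card, mul_div_left_comm, mul_comm, Finset.mul_sum]
    refine Finset.sum_congr rfl fun j hj => ?_
    rw [sandwichWeights, if_neg (Finset.disjoint_right.1 hSB hj), if_pos hj]
  rw [Finset.sum_union (Finset.disjoint_union_right.2 ⟨hKS, hKB⟩), Finset.sum_union hSB, hK, hS, hB]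

lemma exists_mul_add_mul_eq_sum {ι : Type*} {K : Finset ι} {g w : ι → ℝ} {l r : ℝ}
    (hg : ∀ k ∈ K, 0 ≤ g k) (hw : ∀ k ∈ K, w k ∈ Set.Icc l r) :
    ∃ a b : ℝ, 0 ≤ a ∧ 0 ≤ b ∧ a + b = ∑ k ∈ K, g k ∧ a * l + b * r = ∑ k ∈ K, g k * w k := by
  have hseg : ∀ k ∈ K, ∃ a b : ℝ, 0 ≤ a ∧ 0 ≤ b ∧ a + b = 1 ∧ a * l + b * r = w k := fun k hk => by
    have h := hw k hk
    rwa [← segment_eq_Icc (h.1.trans h.2)] at h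
  choose! a b ha hb hab hval using hseg
  refine ⟨∑ k ∈ K, g k * a k, ∑ k ∈ K, g k * b k,
    Finset.sum_nonneg fun k hk => mul_nonneg (hg k hk) (ha k hk),
    Finset.sum_nonneg fun k hk => mul_nonneg (hg k hk) (hb k hk), ?_, ?_⟩
  · rw [← Finset.sum_add_distrib]
    exact Finset.sum_congr rfl fun k hk => by rw [← mul_add, hab k hk, mul_one]
  · rw [Finset.sum_mul, Finset.sum_mul, ← Finset.sum_add_distrib]
    exact Finset.sum_congr rfl fun k hk => by rw [← hval k hk]; ring

lemma four_mul_le_two_pow_succ (n : ℕ) : 4 * n ≤ 2 ^ (n + 1) := by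
  induction n with
  | zero => norm_num
  | succ n ih =>
    have : 2 ≤ 2 ^ (n + 1) := Nat.le_self_pow n.succ_ne_zero 2
    rw [pow_succ]
    omega

lemma half_pow_succ_le_div {a : ℝ} {n f : ℕ} (ha : 1 / 4 ≤ a) (hn : 0 < n) (hnf : n ≤ f) :
    (1 / 2) ^ (f + 1) ≤ a / n := by
  have h4 : (4 * n : ℝ) ≤ 2 ^ (f + 1) := by
    exact_mod_cast (Nat.mul_le_mul_left 4 hnf).trans (four_mul_le_two_pow_succ f)
  have : (0 : ℝ) < n := by exact_mod_cast hn
  calc ((1 : ℝ) / 2) ^ (f + 1) = 1 / 2 ^ (f + 1) := _root_.one_div_pow 2 _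
    _ ≤ 1 / (4 * n) := one_div_le_one_div_of_le (by positivity) h4
    _ = 1 / 4 / n := by rw [div_div]
    _ ≤ a / n := by gcongr

lemma half_pow_succ_le_sandwichWeights {S B : Finset V} {a b : ℝ} {f : ℕ} (hSf : S.card ≤ f)
    (hBf : B.card ≤ f) {j : V} (ha : j ∈ S → 1 / 4 ≤ a) (hb : j ∈ B → 1 / 4 ≤ b) :
    (1 / 2) ^ (f + 1) ≤ sandwichWeights S B a b j := by
  unfold sandwichWeights
  split_ifs with hjS hjB
  · exact half_pow_succ_le_div (ha hjS) (Finset.card_pos.2 ⟨j, hjS⟩) hSf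
  · exact half_pow_succ_le_div (hb hjB) (Finset.card_pos.2 ⟨j, hjB⟩) hBf
  · exact pow_le_of_le_one (by norm_num) (by norm_num) f.succ_ne_zero

/-- Each value at `K`, or half of it at the elements of `K'`, is replaced by the values at `S` and
`B` that surround it; since the shares of `S` and `B` add up to at least `1 / 2`, one of the two is
at least `1 / 4`, and the other set can be neglected. -/
lemma exists_isHonestWeighting_union {K' K S B : Finset V} {w : V → ℝ} {f : ℕ} (hK' : K' ⊆ K)
    (hK : K.Nonempty) (hKS : Disjoint K' S) (hKB : Disjoint K' B) (hSB : Disjoint S B)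
    (hS : S.Nonempty) (hB : B.Nonempty) (hSf : S.card ≤ f) (hBf : B.card ≤ f)
    (hw : ∀ k ∈ K, w k ∈ Set.Icc (𝔼 j ∈ S, w j) (𝔼 j ∈ B, w j)) :
    ∃ c, IsHonestWeighting (K' ∪ (S ∪ B)) K w f c := by
  let g : V → ℝ := fun k => if k ∈ K' then 1 / 2 else 1
  have hg : ∀ k, 1 / 2 ≤ g k := fun k => by simp only [g]; split_ifs <;> norm_num
  have hg0 : ∀ k ∈ K, 0 ≤ g k := fun k _ => le_trans (by norm_num) (hg k)
  obtain ⟨a, b, ha, hb, hab, hval⟩ := exists_mul_add_mul_eq_sum hg0 hw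
  have hmass : 1 / 2 ≤ a + b := by
    obtain ⟨k, hk⟩ := hK
    exact hab ▸ (hg k).trans (Finset.single_le_sum hg0 hk)
  have hsplit : ∀ u : V → ℝ, ∑ k ∈ K, u k = 1 / 2 * ∑ k ∈ K', u k + ∑ k ∈ K, g k * u k := by
    intro u
    have hu : ∀ k ∈ K, u k = (if k ∈ K' then 1 / 2 * u k else 0) + g k * u k := fun k _ => by
      simp only [g]
      split_ifs <;> ring
    rw [Finset.sum_congr rfl hu, Finset.sum_add_distrib, Finset.sum_ite_mem,
      Finset.inter_eq_right.2 hK', Finset.mul_sum]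
  refine ⟨sandwichWeights S B a b, fun j => ?_, ?_, ?_, ?_⟩
  · unfold sandwichWeights
    split_ifs
    exacts [div_nonneg ha (Nat.cast_nonneg _), div_nonneg hb (Nat.cast_nonneg _), one_half_pos.le]
  · rw [sum_sandwichWeights_mul hKS hKB hSB, hval, ← hsplit]
  · have hone := sum_sandwichWeights_mul hKS hKB hSB a b fun _ => 1
    have hK1 := hsplit fun _ => 1
    simp only [mul_one, Finset.expect_const hS, Finset.expect_const hB] at hone hK1
    rw [hone, hab, ← hK1, Finset.sum_const, nsmul_one]
  · rcases le_or_gt (1 / 4) a with ha4 | ha4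
    · exact ⟨B, hBf, fun j _ hjB =>
        half_pow_succ_le_sandwichWeights hSf hBf (fun _ => ha4) fun h => absurd h hjB⟩
    · exact ⟨S, hSf, fun j _ hjS =>
        half_pow_succ_le_sandwichWeights hSf hBf (fun h => absurd h hjS) fun _ => by linarith⟩

lemma IsTrimming.card_add {N : Finset V} {w : V → ℝ} {f : ℕ} {K : Finset V}
    (hK : IsTrimming N w f K) : K.card + 2 * f = N.card := by
  obtain ⟨S, B, hS, hB, hSB, hSf, hBf, -, -, rfl⟩ := hK
  have h := Finset.card_sdiff_add_card_eq_card (Finset.union_subset hS hB)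
  rw [Finset.card_union_of_disjoint hSB] at h
  omega

lemma IsTrimming.exists_isHonestWeighting {N F K : Finset V} {w : V → ℝ} {f : ℕ}
    (hF : F.card ≤ f) (hK : 0 < f → K.Nonempty) (hT : IsTrimming N w f K) :
    ∃ c, IsHonestWeighting (N \ F) K w f c := by
  obtain ⟨S, B, hSN, hBN, hSB, hSf, hBf, hsmall, hbig, rfl⟩ := hT
  rcases (S \ F).eq_empty_or_nonempty with hSF | hSF
  · obtain rfl : S = F :=
      Finset.eq_of_subset_of_card_le (Finset.sdiff_eq_empty_iff_subset.1 hSF) (hF.trans_eq hSf.symm)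
    exact ⟨_, isHonestWeighting_indicator w (by grind)
      ((Finset.card_le_card (by grind)).trans hBf.le)⟩
  rcases (B \ F).eq_empty_or_nonempty with hBF | hBF
  · obtain rfl : B = F :=
      Finset.eq_of_subset_of_card_le (Finset.sdiff_eq_empty_iff_subset.1 hBF) (hF.trans_eq hBf.symm)
    exact ⟨_, isHonestWeighting_indicator w (by grind)
      ((Finset.card_le_card (by grind)).trans hSf.le)⟩
  have hf : 0 < f := hSf ▸ (hSF.mono Finset.sdiff_subset).card_pos
  have hunion : N \ F = (N \ (S ∪ B)) \ F ∪ (S \ F ∪ B \ F) := by grind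
  rw [hunion]
  refine exists_isHonestWeighting_union Finset.sdiff_subset (hK hf) ?_ ?_ ?_ hSF hBF
    ((Finset.card_le_card Finset.sdiff_subset).trans hSf.le)
    ((Finset.card_le_card Finset.sdiff_subset).trans hBf.le) fun k hk => ⟨?_, ?_⟩
  · exact Finset.disjoint_left.2 (by grind)
  · exact Finset.disjoint_left.2 (by grind)
  · exact hSB.mono Finset.sdiff_subset Finset.sdiff_subset
  · exact Finset.expect_le hSF fun s hs => hsmall s (by grind) k (by grind)
  · exact Finset.le_expect hBF fun b hb => hbig b (by grind) k (by grind)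

end Trimming

section Graphs

variable {V : Type*} {G : Digraph V} {f : ℕ} {F : Finset V}

/-- The graph of the agents outside `F` in which, in addition to the agents of `F`, the incoming
edges of each agent `v` from the set `R v` have been removed. -/
def removeIncoming (G : Digraph V) (F : Finset V) (R : {v : V // v ∉ F} → Finset V) :
    Digraph {v : V // v ∉ F} :=
  ⟨fun u v => G.Adj u v ∧ (u : V) ∉ R v⟩

lemma isReducedGraph_removeIncoming (G : Digraph V) (F : Finset V)
    {R : {v : V // v ∉ F} → Finset V} (hR : ∀ v, (R v).card ≤ f) :
    IsReducedGraph G f F (removeIncoming G F R) := by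
  refine ⟨fun u v h => h.1, fun v => le_trans ?_ (hR v)⟩
  rw [← Set.ncard_coe_finset, ← Set.ncard_image_of_injective _ Subtype.val_injective]
  refine Set.ncard_le_ncard ?_ (R v).finite_toSet
  rintro _ ⟨u, ⟨hadj, hremoved⟩, rfl⟩
  exact not_not.1 fun hu => hremoved ⟨hadj, hu⟩

variable [Fintype V]

lemma mem_inNbrs {i j : V} : j ∈ inNbrs G i ↔ G.Adj j i := by
  simp [inNbrs]

/-- Otherwise one could remove `f` of the `2 * f` neighbours of `i` as agents, the edges from the
other `f` to `i`, and the edge from `i` to everyone else: nothing enters `i` and nothing leaves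
it. -/
lemma inDegree_ne_two_mul (hloop : ∀ v, ¬ G.Adj v v) (hf : 0 < f)
    (hG : ∀ F' : Finset V, F'.card ≤ f → ∀ H, IsReducedGraph G f F' H →
      (sourceComponent H).Nonempty) (i : V) : inDegree G i ≠ 2 * f := by
  classical
  intro hdeg
  obtain ⟨A, hAsub, hAcard⟩ := Finset.exists_subset_card_eq (s := inNbrs G i) (n := f)
    (by rw [inDegree] at hdeg; omega)
  have hrest : (inNbrs G i \ A).card = f := by
    rw [Finset.card_sdiff_of_subset hAsub, hAcard]
    rw [inDegree] at hdeg
    omega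
  let R : {v : V // v ∉ A} → Finset V := fun v => if (v : V) = i then inNbrs G i \ A else {i}
  have hR : ∀ v, (R v).card ≤ f := fun v => by
    simp only [R]
    split_ifs
    exacts [hrest.le, Finset.card_singleton i ▸ hf]
  obtain ⟨s, hs⟩ := hG A hAcard.le _ (isReducedGraph_removeIncoming G A hR)
  have hiA : i ∉ A := fun h => hloop i (mem_inNbrs.1 (hAsub h))
  obtain ⟨u, hu⟩ : (inNbrs G i \ A).Nonempty := Finset.card_pos.1 (hrest ▸ hf)
  have hui : u ≠ i := fun h => hloop i (mem_inNbrs.1 (h ▸ (Finset.mem_sdiff.1 hu).1))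
  have hno_in : ∀ v, ¬ (removeIncoming G A R).Adj v ⟨i, hiA⟩ := fun v hv =>
    hv.2 (by simpa [R, v.2] using mem_inNbrs.2 hv.1)
  have hno_out : ∀ v, ¬ (removeIncoming G A R).Adj ⟨i, hiA⟩ v := fun v hv =>
    hv.2 (by
      have hvi : (v : V) ≠ i := fun h => hloop i (h ▸ hv.1)
      simp [R, hvi])
  obtain rfl : ⟨i, hiA⟩ = s :=
    (Relation.ReflTransGen.cases_tail (hs ⟨i, hiA⟩)).resolve_right
      fun ⟨v, _, hv⟩ => hno_in v hv
  rcases Relation.ReflTransGen.cases_head (hs ⟨u, (Finset.mem_sdiff.1 hu).2⟩) with h | ⟨v, hv, -⟩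
  · exact hui (congrArg Subtype.val h).symm
  · exact hno_out v hv

/-- Count only the reduced graphs that arise by removing edges at `i`. -/
lemma two_pow_le_numReducedGraphs [DecidableEq V] {i : V} (hi : i ∉ F)
    (hcard : f ≤ (inNbrs G i \ F).card) : 2 ^ f ≤ numReducedGraphs G f F := by
  classical
  obtain ⟨T, hT, rfl⟩ := Finset.exists_subset_card_eq hcard
  let removeAt : Finset V → Digraph {v : V // v ∉ F} := fun S =>
    removeIncoming G F fun v => if (v : V) = i then S else ∅
  have hmaps : ∀ S ∈ (T.powerset : Set (Finset V)),
      removeAt S ∈ {H : Digraph {v : V // v ∉ F} | IsReducedGraph G T.card F H} := by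
    intro S hS
    refine isReducedGraph_removeIncoming G F fun v => ?_
    split_ifs
    exacts [Finset.card_le_card (by simpa using hS), Nat.zero_le _]
  have hinj : Set.InjOn removeAt (T.powerset : Set (Finset V)) := by
    intro S hS S' hS' h
    have hmem : ∀ u ∈ T, (u ∈ S ↔ u ∈ S') := by
      intro u hu
      obtain ⟨huN, huF⟩ := Finset.mem_sdiff.1 (hT hu)
      have hadj := congrArg (fun H : Digraph {v : V // v ∉ F} => H.Adj ⟨u, huF⟩ ⟨i, hi⟩) h
      simpa [removeAt, removeIncoming, mem_inNbrs.1 huN, not_iff_not] using hadj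
    rw [Finset.mem_coe, Finset.mem_powerset] at hS hS'
    exact Finset.ext fun u => ⟨fun hu => (hmem u (hS hu)).1 hu, fun hu => (hmem u (hS' hu)).2 hu⟩
  have hle := Set.ncard_le_ncard_of_injOn removeAt hmaps hinj (Set.toFinite _)
  rwa [Set.ncard_coe_finset, Finset.card_powerset] at hle

end Graphs

section Subgradients

/-- `g` selects a subgradient of the function `h` at every point of `X`. -/
def IsSubgradientOn (X : Set ℝ) (h g : ℝ → ℝ) : Prop :=
  ∀ x ∈ X, ∀ y ∈ X, h x + g x * (y - x) ≤ h y

variable {X : Set ℝ} {L : ℝ} {h g : ℝ → ℝ} {x y z : ℝ}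

lemma Admissible.isSubgradientOn {h' : ℝ → ℝ} (hh : Admissible X L h h') :
    IsSubgradientOn X h h' := by
  intro x hx y hy
  rcases lt_trichotomy x y with hxy | rfl | hxy
  · have hslope := hh.convex.le_slope_of_hasDerivWithinAt hx hy hxy (hh.hasDeriv x hx)
    rw [slope_def_field, le_div_iff₀ (sub_pos.2 hxy)] at hslope
    linarith
  · simp
  · have hslope := hh.convex.slope_le_of_hasDerivWithinAt hy hx hxy (hh.hasDeriv x hx)
    rw [slope_def_field, div_le_iff₀ (sub_pos.2 hxy)] at hslope
    linarith

namespace IsSubgradientOn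

lemma monotoneOn (hg : IsSubgradientOn X h g) : MonotoneOn g X := by
  intro x hx y hy hxy
  rcases hxy.eq_or_lt with rfl | hxy
  · rfl
  · have hmul : 0 ≤ (g y - g x) * (y - x) := by linarith [hg x hx y hy, hg y hy x hx]
    exact sub_nonneg.1 (nonneg_of_mul_nonneg_left hmul (sub_pos.2 hxy))

lemma sum {ι : Type*} {s : Finset ι} {h g : ι → ℝ → ℝ}
    (hg : ∀ i ∈ s, IsSubgradientOn X (h i) (g i)) {α : ι → ℝ} (hα : ∀ i ∈ s, 0 ≤ α i) :
    IsSubgradientOn X (fun x => ∑ i ∈ s, α i * h i x) fun x => ∑ i ∈ s, α i * g i x := by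
  intro x hx y hy
  simp only [Finset.sum_mul, ← Finset.sum_add_distrib]
  refine Finset.sum_le_sum fun i hi => ?_
  rw [mul_assoc, ← mul_add]
  exact mul_le_mul_of_nonneg_left (hg i hi x hx y hy) (hα i hi)

lemma mem_argminOn_of_eq_zero (hg : IsSubgradientOn X h g) (hx : x ∈ X) (hzero : g x = 0) :
    x ∈ argminOn X h :=
  ⟨hx, fun y hy => by simpa [hzero] using hg x hx y hy⟩

lemma nonneg_of_argmin_lt (hg : IsSubgradientOn X h g) (hy : y ∈ argminOn X h) (hx : x ∈ X)
    (hyx : y < x) : 0 ≤ g x := by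
  have hmul : 0 ≤ g x * (x - y) := by linarith [hg x hx y hy.1, hy.2 x hx]
  exact nonneg_of_mul_nonneg_left hmul (sub_pos.2 hyx)

lemma nonpos_of_lt_argmin (hg : IsSubgradientOn X h g) (hy : y ∈ argminOn X h) (hx : x ∈ X)
    (hxy : x < y) : g x ≤ 0 := by
  have hmul : g x * (y - x) ≤ 0 := by linarith [hg x hx y hy.1, hy.2 x hx]
  exact nonpos_of_mul_nonpos_left hmul (sub_pos.2 hxy)

lemma le_of_argmin_le_of_le (hg : IsSubgradientOn X h g) (hy : y ∈ argminOn X h) (hx : x ∈ X)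
    (hz : z ∈ X) (hyx : y ≤ x) (hxz : x ≤ z) : h x ≤ h z := by
  rcases hyx.eq_or_lt with rfl | hyx
  · exact hy.2 z hz
  · linarith [hg x hx z hz, mul_nonneg (hg.nonneg_of_argmin_lt hy hx hyx) (sub_nonneg.2 hxz)]

lemma le_of_le_of_le_argmin (hg : IsSubgradientOn X h g) (hy : y ∈ argminOn X h) (hx : x ∈ X)
    (hz : z ∈ X) (hzx : z ≤ x) (hxy : x ≤ y) : h x ≤ h z := by
  rcases hxy.eq_or_lt with rfl | hxy
  · exact hy.2 z hz
  · linarith [hg x hx z hz,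
      mul_nonneg_of_nonpos_of_nonpos (hg.nonpos_of_lt_argmin hy hx hxy) (sub_nonpos.2 hzx)]

lemma lowerSemicontinuousOn (hg : IsSubgradientOn X h g) : LowerSemicontinuousOn h X := by
  intro x hx c hc
  have htangent : ContinuousAt (fun y => h x + g x * (y - x)) x := by fun_prop
  filter_upwards [nhdsWithin_le_nhds (htangent.eventually_const_lt (by simpa using hc)),
    self_mem_nhdsWithin] with y hy hyX
  exact hy.trans_le (hg x hx y hyX)

end IsSubgradientOn

/-- A sum decreases when its argument moves to the interval spanned by minimizers of the summands,
so a minimizer over this compact interval is a minimizer over `X`. -/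
lemma argminOn_sum_nonempty {ι : Type*} {s : Finset ι} (hs : s.Nonempty) (hX : Convex ℝ X)
    {h g : ι → ℝ → ℝ} (hg : ∀ i ∈ s, IsSubgradientOn X (h i) (g i))
    (hmin : ∀ i ∈ s, (argminOn X (h i)).Nonempty) {α : ι → ℝ} (hα : ∀ i ∈ s, 0 ≤ α i) :
    (argminOn X fun x => ∑ i ∈ s, α i * h i x).Nonempty := by
  choose! y hy using hmin
  obtain ⟨k, hks, hk⟩ := s.exists_min_image y hs
  obtain ⟨l, hls, hl⟩ := s.exists_max_image y hs
  have hkl : y k ≤ y l := hk l hls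
  have hIcc : Set.Icc (y k) (y l) ⊆ X := hX.ordConnected.out (hy k hks).1 (hy l hls).1
  obtain ⟨z, hz, hzmin⟩ := ((IsSubgradientOn.sum hg hα).lowerSemicontinuousOn.mono
    hIcc).exists_isMinOn (Set.nonempty_Icc.2 hkl) isCompact_Icc
  refine ⟨z, hIcc hz, fun x hx => ?_⟩
  rcases le_total x (y k) with hxk | hxk
  · exact (hzmin ⟨le_rfl, hkl⟩).trans (Finset.sum_le_sum fun i hi => mul_le_mul_of_nonneg_left
      ((hg i hi).le_of_le_of_le_argmin (hy i hi) (hy k hks).1 hx hxk (hk i hi)) (hα i hi))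
  rcases le_total x (y l) with hxl | hxl
  · exact hzmin ⟨hxk, hxl⟩
  · exact (hzmin ⟨hkl, le_rfl⟩).trans (Finset.sum_le_sum fun i hi => mul_le_mul_of_nonneg_left
      ((hg i hi).le_of_argmin_le_of_le (hy i hi) (hy l hls).1 hx (hl i hi) hxl) (hα i hi))

end Subgradients

section WeightedMinimizers

lemma exists_pos_forall_le_of_forall_ne_zero {E : Type*} [TopologicalSpace E] {A : Set E}
    {φ : E → ℝ} (hcomp : IsCompact A) (hconn : IsPreconnected A) (hφ : ContinuousOn φ A)
    (hne : ∀ a ∈ A, φ a ≠ 0) {a : E} (ha : a ∈ A) (hnonneg : 0 ≤ φ a) :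
    ∃ c > 0, ∀ a ∈ A, c ≤ φ a := by
  obtain ⟨b, hb, hmin⟩ := hcomp.exists_isMinOn ⟨a, ha⟩ hφ
  refine ⟨φ b, ?_, fun a ha => hmin ha⟩
  by_contra! hnonpos
  obtain ⟨a', ha', hzero⟩ := hconn.intermediate_value hb ha hφ ⟨hnonpos, hnonneg⟩
  exact hne a' ha' hzero

variable {W : Type*} [Fintype W]

/-- The convex weights on `W` that define the valid functions: at least `γ` of them are at
least `β`. -/
def validWeights (W : Type*) [Fintype W] (β : ℝ) (γ : ℕ) : Set (W → ℝ) :=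
  {α | α ∈ stdSimplex ℝ W ∧ γ ≤ {i | β ≤ α i}.ncard}

lemma isCompact_validWeights (β : ℝ) (γ : ℕ) : IsCompact (validWeights W β γ) := by
  have heq : validWeights W β γ =
      stdSimplex ℝ W ∩ ⋃ S ∈ {S : Set W | γ ≤ S.ncard}, {α | ∀ i ∈ S, β ≤ α i} := by
    ext α
    simp only [validWeights, Set.mem_ofPred_eq, Set.mem_inter_iff, Set.mem_iUnion, exists_prop]
    refine and_congr_right fun _ => ⟨fun hα => ⟨_, hα, fun _ => id⟩, ?_⟩
    rintro ⟨S, hS, hSα⟩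
    exact hS.trans (Set.ncard_le_ncard hSα (Set.toFinite _))
  rw [heq]
  refine (isCompact_stdSimplex ℝ W).inter_right
    ((Set.toFinite _).isClosed_biUnion fun S _ => ?_)
  simp only [Set.ofPred_forall]
  exact isClosed_biInter fun i _ => isClosed_le continuous_const (continuous_apply i)

section Uniform

variable [Nonempty W] {β : ℝ} {γ : ℕ} (hγ : γ ≤ Fintype.card W)
  (hβ : β ≤ (Fintype.card W : ℝ)⁻¹)

include hγ hβ

lemma uniform_mem_validWeights : (fun _ => (Fintype.card W : ℝ)⁻¹) ∈ validWeights W β γ :=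
  ⟨⟨fun i => by positivity, by simp⟩, by simpa [hβ, Set.ncard_univ] using hγ⟩

lemma starConvex_validWeights :
    StarConvex ℝ (fun _ => (Fintype.card W : ℝ)⁻¹) (validWeights W β γ) := by
  intro α hα a b ha hb hab
  refine ⟨convex_stdSimplex ℝ W (uniform_mem_validWeights hγ hβ).1 hα.1 ha hb hab,
    hα.2.trans (Set.ncard_le_ncard (fun i hi => ?_) (Set.toFinite _))⟩
  exact convex_Ici β hβ hi ha hb hab

lemma isPreconnected_validWeights : IsPreconnected (validWeights W β γ) :=
  ((starConvex_validWeights hγ hβ).isPathConnected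
    (uniform_mem_validWeights hγ hβ)).isConnected.isPreconnected

end Uniform

/-- The minimizers over `X` of the functions `∑ i, α i * h i` with weights `α` in `A`. -/
def weightedArgmin (X : Set ℝ) (h : W → ℝ → ℝ) (A : Set (W → ℝ)) : Set ℝ :=
  ⋃ α ∈ A, argminOn X fun y => ∑ i, α i * h i y

variable {X : Set ℝ} {h g : W → ℝ → ℝ} {A : Set (W → ℝ)} {x : ℝ}

lemma mem_weightedArgmin :
    x ∈ weightedArgmin X h A ↔ ∃ α ∈ A, x ∈ argminOn X fun y => ∑ i, α i * h i y := by
  simp only [weightedArgmin, Set.mem_iUnion, exists_prop]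

lemma weightedArgmin_subset : weightedArgmin X h A ⊆ X :=
  Set.iUnion₂_subset fun _ _ _ hx => hx.1

lemma weightedArgmin_nonempty [Nonempty W] (hX : Convex ℝ X)
    (hg : ∀ i, IsSubgradientOn X (h i) (g i)) (hmin : ∀ i, (argminOn X (h i)).Nonempty)
    (hA : ∀ α ∈ A, 0 ≤ α) (hne : A.Nonempty) : (weightedArgmin X h A).Nonempty := by
  obtain ⟨α, hα⟩ := hne
  obtain ⟨y, hy⟩ := argminOn_sum_nonempty Finset.univ_nonempty hX (fun i _ => hg i)
    (fun i _ => hmin i) fun i _ => hA α hα i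
  exact ⟨y, mem_weightedArgmin.2 ⟨α, hα, hy⟩⟩

section Subgradient

variable (hg : ∀ i, IsSubgradientOn X (h i) (g i)) (hA : ∀ α ∈ A, 0 ≤ α) (hconn : IsPreconnected A)

include hg hA

lemma mem_weightedArgmin_of_sum_eq_zero {α : W → ℝ} (hα : α ∈ A) (hx : x ∈ X)
    (hzero : ∑ i, α i * g i x = 0) : x ∈ weightedArgmin X h A :=
  mem_weightedArgmin.2 ⟨α, hα, (IsSubgradientOn.sum (fun i _ => hg i)
    fun i _ => hA α hα i).mem_argminOn_of_eq_zero hx hzero⟩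

include hconn

lemma ordConnected_weightedArgmin (hX : Convex ℝ X) : (weightedArgmin X h A).OrdConnected := by
  refine ⟨fun y hy z hz x ⟨hyx, hxz⟩ => ?_⟩
  obtain ⟨α, hα, hαy⟩ := mem_weightedArgmin.1 hy
  obtain ⟨α', hα', hαz⟩ := mem_weightedArgmin.1 hz
  rcases hyx.eq_or_lt with rfl | hyx
  · exact hy
  rcases hxz.eq_or_lt with rfl | hxz
  · exact hz
  have hx : x ∈ X := hX.ordConnected.out hαy.1 hαz.1 ⟨hyx.le, hxz.le⟩
  have hsub : ∀ α ∈ A, IsSubgradientOn X (fun x => ∑ i, α i * h i x) fun x => ∑ i, α i * g i x :=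
    fun α hα => IsSubgradientOn.sum (fun i _ => hg i) fun i _ => hA α hα i
  obtain ⟨α₀, hα₀, hzero⟩ := hconn.intermediate_value (f := fun α => ∑ i, α i * g i x)
    hα' hα (by fun_prop) ⟨(hsub α' hα').nonpos_of_lt_argmin hαz hx hxz,
      (hsub α hα).nonneg_of_argmin_lt hαy hx hyx⟩
  exact mem_weightedArgmin_of_sum_eq_zero hg hA hα₀ hx hzero

lemma exists_pos_le_sum_of_forall_weightedArgmin_lt (hcomp : IsCompact A)
    (hne : (weightedArgmin X h A).Nonempty) (hx : x ∈ X)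
    (hlt : ∀ y ∈ weightedArgmin X h A, y < x) : ∃ c > 0, ∀ α ∈ A, c ≤ ∑ i, α i * g i x := by
  obtain ⟨y, hy⟩ := hne
  obtain ⟨α, hα, hαy⟩ := mem_weightedArgmin.1 hy
  refine exists_pos_forall_le_of_forall_ne_zero hcomp hconn (by fun_prop)
    (fun α hα hzero => ?_) hα ((IsSubgradientOn.sum (fun i _ => hg i)
      fun i _ => hA α hα i).nonneg_of_argmin_lt hαy hx (hlt y hy))
  exact lt_irrefl x (hlt x (mem_weightedArgmin_of_sum_eq_zero hg hA hα hx hzero))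

end Subgradient

end WeightedMinimizers

section Projection

variable {X : Set ℝ} {u v z L : ℝ}

lemma IsProjection.mul_nonpos (hX : Convex ℝ X) (hz : IsProjection X u z) (hv : v ∈ X) :
    (u - z) * (v - z) ≤ 0 := by
  by_contra! hpos
  rcases pos_and_pos_or_neg_and_neg_of_mul_pos hpos with ⟨hu, hv'⟩ | ⟨hu, hv'⟩
  · have hmem : min u v ∈ X :=
      hX.ordConnected.out hz.1 hv ⟨le_min (by linarith) (by linarith), min_le_right u v⟩
    have hlt : z < min u v := lt_min (by linarith) (by linarith)
    have hnear := hz.2 _ hmem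
    rw [abs_of_neg (by linarith), abs_of_nonpos (by linarith [min_le_left u v])] at hnear
    linarith
  · have hmem : max u v ∈ X :=
      hX.ordConnected.out hv hz.1 ⟨le_max_right u v, max_le (by linarith) (by linarith)⟩
    have hlt : max u v < z := max_lt (by linarith) (by linarith)
    have hnear := hz.2 _ hmem
    rw [abs_of_pos (by linarith), abs_of_nonneg (by linarith [le_max_left u v])] at hnear
    linarith

lemma IsProjection.le_of_le (hX : Convex ℝ X) (hz : IsProjection X u z) (hv : v ∈ X)
    (hvu : v ≤ u) : z ≤ u := by
  by_contra! huz
  exact (mul_pos_of_neg_of_neg (sub_neg.2 huz) (sub_neg.2 (hvu.trans_lt huz))).not_ge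
    (hz.mul_nonpos hX hv)

lemma IsProjection.abs_sub_le (hX : Convex ℝ X) (hz : IsProjection X u z) (hv : v ∈ X) :
    |z - v| ≤ |u - v| := by
  refine sq_le_sq.1 ?_
  calc (z - v) ^ 2 ≤ (u - z) ^ 2 + (z - v) ^ 2 - 2 * ((u - z) * (v - z)) := by
        linarith [hz.mul_nonpos hX hv, sq_nonneg (u - z)]
    _ = (u - v) ^ 2 := by ring

lemma IsProjection.neg (hz : IsProjection X u z) : IsProjection (-X) (-u) (-z) := by
  refine ⟨by simpa using hz.1, fun y hy => ?_⟩
  calc |-z - -u| = |z - u| := by rw [neg_sub_neg, abs_sub_comm]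
    _ ≤ |-y - u| := hz.2 _ hy
    _ = |y - -u| := by rw [← neg_add', abs_neg, sub_neg_eq_add]

lemma IsProjection.abs_sub_le_of_step {lam d : ℝ} (hX : Convex ℝ X)
    (hz : IsProjection X (v - lam * d) z) (hv : v ∈ X) (hlam : 0 ≤ lam) (hd : |d| ≤ L) :
    |z - v| ≤ L * lam := by
  calc |z - v| ≤ |v - lam * d - v| := hz.abs_sub_le hX hv
    _ = |d| * lam := by rw [sub_sub_cancel_left, abs_neg, abs_mul, abs_of_nonneg hlam, mul_comm]
    _ ≤ L * lam := mul_le_mul_of_nonneg_right hd hlam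

end Projection

section Reflection

variable {X : Set ℝ}

lemma IsSubgradientOn.neg {h g : ℝ → ℝ} (hg : IsSubgradientOn X h g) :
    IsSubgradientOn (-X) (fun x => h (-x)) fun x => -g (-x) := by
  intro x hx y hy
  linarith [hg (-x) hx (-y) hy]

lemma argminOn_neg (h : ℝ → ℝ) : argminOn (-X) (fun x => h (-x)) = -argminOn X h := by
  ext x
  refine and_congr_right fun _ => ⟨fun hx y hy => ?_, fun hx y hy => hx (-y) hy⟩
  simpa using hx (-y) (by simpa using hy)

lemma weightedArgmin_neg {W : Type*} [Fintype W] (h : W → ℝ → ℝ) (A : Set (W → ℝ)) :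
    weightedArgmin (-X) (fun i x => h i (-x)) A = -weightedArgmin X h A := by
  ext x
  rw [Set.mem_neg, mem_weightedArgmin, mem_weightedArgmin]
  refine exists_congr fun α => and_congr_right fun _ => ?_
  rw [argminOn_neg fun x => ∑ i, α i * h i x, Set.mem_neg]

end Reflection

section Descent

variable {z lam : ℕ → ℝ} {s c L ε : ℝ}

lemma exists_lt_of_descent (hc : 0 < c)
    (hsum : Tendsto (fun T => ∑ t ∈ Finset.range T, lam t) atTop atTop) {T : ℕ}
    (hdesc : ∀ t ≥ T, s ≤ z t → z (t + 1) ≤ z t - c * lam t) : ∃ t ≥ T, z t < s := by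
  by_contra! hcon
  have hbound : ∀ t ≥ T, z t + c * ∑ r ∈ Finset.range t, lam r ≤
      z T + c * ∑ r ∈ Finset.range T, lam r := by
    intro t ht
    induction t, ht using Nat.le_induction with
    | base => rfl
    | succ t ht ih =>
      rw [Finset.sum_range_succ, mul_add]
      linarith [hdesc t ht (hcon t ht)]
  obtain ⟨t, hlarge, ht⟩ := (((hsum.const_mul_atTop hc).eventually_gt_atTop
    (z T + c * ∑ r ∈ Finset.range T, lam r - s)).and (eventually_ge_atTop T)).exists
  linarith [hbound t ht, hcon t ht]

/-- The sequence falls below `s` again and again, and from there a single step cannot climb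
above `s + ε`. -/
lemma eventually_lt_of_descent (hε : 0 < ε) (hc : 0 < c) (hlam : ∀ t, 0 ≤ lam t)
    (hlam0 : Tendsto lam atTop (𝓝 0))
    (hsum : Tendsto (fun T => ∑ t ∈ Finset.range T, lam t) atTop atTop)
    (hstep : ∀ t, z (t + 1) ≤ z t + L * lam t)
    (hdesc : ∀ᶠ t in atTop, s ≤ z t → z (t + 1) ≤ z t - c * lam t) :
    ∀ᶠ t in atTop, z t < s + ε := by
  have hsmall : ∀ᶠ t in atTop, L * lam t < ε :=
    (hlam0.const_mul L).eventually_lt_const (by simpa using hε)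
  obtain ⟨T, hT⟩ := eventually_atTop.1 (hdesc.and hsmall)
  obtain ⟨t₀, ht₀, hz₀⟩ := exists_lt_of_descent hc hsum fun t ht => (hT t ht).1
  refine eventually_atTop.2 ⟨t₀, fun t ht => ?_⟩
  induction t, ht using Nat.le_induction with
  | base => linarith
  | succ t ht ih =>
    obtain ⟨hdown, hup⟩ := hT t (ht₀.trans ht)
    rcases lt_or_ge (z t) s with hlt | hge
    · linarith [hstep t]
    · linarith [hdown hge, mul_nonneg hc.le (hlam t)]

end Descent

section SubgradientMethod

variable {W : Type*} [Fintype W]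

lemma dotProduct_const_of_mem_stdSimplex {p : W → ℝ} (hp : p ∈ stdSimplex ℝ W) (b : ℝ) :
    p ⬝ᵥ (fun _ => b) = b := by
  rw [dotProduct, ← Finset.sum_mul, hp.2, one_mul]

lemma abs_dotProduct_sub_le {p : W → ℝ} (hp : p ∈ stdSimplex ℝ W) {u v : W → ℝ} {c : ℝ}
    (huv : ∀ i, |u i - v i| ≤ c) : |p ⬝ᵥ u - p ⬝ᵥ v| ≤ c := by
  rw [← dotProduct_sub]
  calc |p ⬝ᵥ (u - v)| ≤ ∑ i, |p i * (u i - v i)| := Finset.abs_sum_le_sum_abs _ _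
    _ = p ⬝ᵥ fun i => |u i - v i| :=
      Finset.sum_congr rfl fun i _ => by rw [abs_mul, abs_of_nonneg (hp.1 i)]
    _ ≤ p ⬝ᵥ fun _ => c := dotProduct_le_dotProduct_of_nonneg_left huv hp.1
    _ = c := dotProduct_const_of_mem_stdSimplex hp c

lemma eventually_forall_abs_sub_dotProduct_le {p x : ℕ → W → ℝ} (hp : ∀ t, p t ∈ stdSimplex ℝ W)
    (hcons : ∀ i j, Tendsto (fun t => |x t i - x t j|) atTop (𝓝 0)) {ε : ℝ} (hε : 0 < ε) :
    ∀ᶠ t in atTop, ∀ i, |x t i - p t ⬝ᵥ x t| ≤ ε := by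
  have hclose : ∀ᶠ t in atTop, ∀ i j, |x t i - x t j| < ε :=
    eventually_all.2 fun i => eventually_all.2 fun j => (hcons i j).eventually_lt_const hε
  filter_upwards [hclose] with t ht i
  have habs := abs_dotProduct_sub_le (hp t) (v := x t) fun j => (ht i j).le
  rwa [dotProduct_const_of_mem_stdSimplex (hp t)] at habs

lemma dotProduct_mem_of_convex {X : Set ℝ} (hX : Convex ℝ X) {p : W → ℝ}
    (hp : p ∈ stdSimplex ℝ W) {y : W → ℝ} (hy : ∀ i, y i ∈ X) : p ⬝ᵥ y ∈ X :=
  hX.sum_mem (fun i _ => hp.1 i) hp.2 fun i _ => hy i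

lemma mulVec_mem_of_convex [DecidableEq W] {X : Set ℝ} (hX : Convex ℝ X) {P : Matrix W W ℝ}
    (hP : P ∈ rowStochastic ℝ W) {y : W → ℝ} (hy : ∀ i, y i ∈ X) (i : W) : (P *ᵥ y) i ∈ X :=
  dotProduct_mem_of_convex hX ⟨hP.1 i, sum_row_of_mem_rowStochastic hP i⟩ hy

variable [DecidableEq W]

/-- The states `x` arise from the distributed projected subgradient method over `X` for the costs
`h` with subgradients `g` bounded by `L`: in iteration `t` the agents average their states with the
row stochastic matrix `M t` and then make a subgradient step of size `lam t`. -/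
structure IsSubgradientMethod (X : Set ℝ) (L : ℝ) (h g : W → ℝ → ℝ) (M : ℕ → Matrix W W ℝ)
    (lam : ℕ → ℝ) (x : ℕ → W → ℝ) : Prop where
  convex : Convex ℝ X
  subgradient : ∀ i, IsSubgradientOn X (h i) (g i)
  bounded : ∀ i, ∀ y ∈ X, |g i y| ≤ L
  stochastic : ∀ t, M t ∈ rowStochastic ℝ W
  step_nonneg : ∀ t, 0 ≤ lam t
  step_tendsto : Tendsto lam atTop (𝓝 0)
  step_sum : Tendsto (fun T => ∑ t ∈ Finset.range T, lam t) atTop atTop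
  mem : ∀ t i, x t i ∈ X
  update : ∀ t i, IsProjection X ((M t *ᵥ x t) i - lam t * g i (x t i)) (x (t + 1) i)

namespace IsSubgradientMethod

variable {X : Set ℝ} {L : ℝ} {h g : W → ℝ → ℝ} {M : ℕ → Matrix W W ℝ} {lam : ℕ → ℝ}
  {x : ℕ → W → ℝ}

lemma neg (hx : IsSubgradientMethod X L h g M lam x) :
    IsSubgradientMethod (-X) L (fun i y => h i (-y)) (fun i y => -g i (-y)) M lam (-x) where
  convex := hx.convex.neg
  subgradient i := (hx.subgradient i).neg
  bounded i y hy := by rw [abs_neg]; exact hx.bounded i _ hy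
  stochastic := hx.stochastic
  step_nonneg := hx.step_nonneg
  step_tendsto := hx.step_tendsto
  step_sum := hx.step_sum
  mem t i := by simpa using hx.mem t i
  update t i := by
    change IsProjection (-X) _ (-x (t + 1) i)
    convert (hx.update t i).neg using 1
    simp only [Pi.neg_apply, Matrix.mulVec_neg, neg_neg]
    ring

lemma tendsto_mul_step (hx : IsSubgradientMethod X L h g M lam x) :
    Tendsto (fun t => L * lam t) atTop (𝓝 0) := by
  simpa using hx.step_tendsto.const_mul L

lemma abs_sub_mulVec_le (hx : IsSubgradientMethod X L h g M lam x) (t : ℕ) (i : W) :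
    |x (t + 1) i - (M t *ᵥ x t) i| ≤ L * lam t :=
  (hx.update t i).abs_sub_le_of_step hx.convex
    (mulVec_mem_of_convex hx.convex (hx.stochastic t) (hx.mem t) i) (hx.step_nonneg t)
    (hx.bounded i _ (hx.mem t i))

lemma tendsto_abs_sub [Nonempty W] (hx : IsSubgradientMethod X L h g M lam x) {ν : ℕ}
    (hν : ν ≠ 0) {δ : ℝ} (hδ : 0 < δ) (hcol : ∀ t, ∃ j, ∀ i, δ ≤ stepProduct M t ν i j) (i k : W) :
    Tendsto (fun t => |x t i - x t k|) atTop (𝓝 0) :=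
  tendsto_abs_sub_of_column hx.stochastic hx.abs_sub_mulVec_le hx.tendsto_mul_step hν hδ hcol i k

section Average

variable {p : ℕ → W → ℝ} (hx : IsSubgradientMethod X L h g M lam x) (hp : IsAbsoluteProbability M p)

include hx hp

lemma dotProduct_succ_le (t : ℕ) : p (t + 1) ⬝ᵥ x (t + 1) ≤ p t ⬝ᵥ x t + L * lam t := by
  have habs := abs_dotProduct_sub_le (hp.mem_stdSimplex (t + 1)) (hx.abs_sub_mulVec_le t)
  rw [hp.dotProduct_mulVec] at habs
  linarith [(abs_le.1 habs).2]

/-- As long as all states stay to the right of `y`, the subgradients at the states are at least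
those at `y`, and the projection can only move to the left. -/
lemma dotProduct_succ_le_sub {t : ℕ} {y : ℝ} (hy : y ∈ X) (hyx : ∀ i, y + L * lam t ≤ x t i) :
    p (t + 1) ⬝ᵥ x (t + 1) ≤ p t ⬝ᵥ x t - lam t * ∑ i, p (t + 1) i * g i y := by
  have hnext : x (t + 1) ≤ M t *ᵥ x t - lam t • fun i => g i y := by
    intro i
    have hbound := (abs_le.1 (hx.bounded i _ (hx.mem t i))).2
    have hL : 0 ≤ L * lam t :=
      mul_nonneg ((abs_nonneg _).trans (hx.bounded i _ hy)) (hx.step_nonneg t)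
    have hstep := mul_le_mul_of_nonneg_left hbound (hx.step_nonneg t)
    have haverage : y + L * lam t ≤ (M t *ᵥ x t) i := by
      simpa [mulVec_const (hx.stochastic t)] using mulVec_mono (hx.stochastic t) hyx i
    have hleft := (hx.update t i).le_of_le hx.convex hy (by linarith)
    have hmono := mul_le_mul_of_nonneg_left ((hx.subgradient i).monotoneOn hy (hx.mem t i)
      (by linarith [hyx i])) (hx.step_nonneg t)
    simp only [Pi.sub_apply, Pi.smul_apply, smul_eq_mul]
    linarith
  calc p (t + 1) ⬝ᵥ x (t + 1)
      ≤ p (t + 1) ⬝ᵥ (M t *ᵥ x t - lam t • fun i => g i y) :=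
        dotProduct_le_dotProduct_of_nonneg_left hnext (hp.mem_stdSimplex (t + 1)).1
    _ = p t ⬝ᵥ x t - lam t * ∑ i, p (t + 1) i * g i y := by
        rw [dotProduct_sub, dotProduct_smul, hp.dotProduct_mulVec, smul_eq_mul]
        rfl

variable (hcons : ∀ i j, Tendsto (fun t => |x t i - x t j|) atTop (𝓝 0))

include hcons

lemma eventually_dotProduct_lt {y c ε : ℝ} (hy : y ∈ X) (hc : 0 < c) (hε : 0 < ε)
    (hgrad : ∀ t, c ≤ ∑ i, p t i * g i y) : ∀ᶠ t in atTop, p t ⬝ᵥ x t < y + ε := by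
  have hε4 : 0 < ε / 4 := by positivity
  suffices hlt : ∀ᶠ t in atTop, p t ⬝ᵥ x t < (y + ε / 2) + ε / 2 by
    simpa only [add_assoc, add_halves] using hlt
  refine eventually_lt_of_descent (c := c) (half_pos hε) hc hx.step_nonneg hx.step_tendsto
    hx.step_sum (hx.dotProduct_succ_le hp) ?_
  filter_upwards [hx.tendsto_mul_step.eventually_lt_const hε4,
    eventually_forall_abs_sub_dotProduct_le hp.mem_stdSimplex hcons hε4] with t hsmall hnear hz
  have hdown := hx.dotProduct_succ_le_sub hp (t := t) hy fun i => by
    linarith [(abs_le.1 (hnear i)).1]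
  linarith [mul_le_mul_of_nonneg_left (hgrad (t + 1)) (hx.step_nonneg t)]

variable {A : Set (W → ℝ)} (hA : ∀ α ∈ A, 0 ≤ α) (hcomp : IsCompact A) (hconn : IsPreconnected A)
  (hne : (weightedArgmin X h A).Nonempty) (hpA : ∀ t, p t ∈ A)

include hA hcomp hconn hne hpA

lemma eventually_exists_mem_weightedArgmin_lt {ε : ℝ} (hε : 0 < ε) :
    ∀ᶠ t in atTop, ∃ y ∈ weightedArgmin X h A, p t ⬝ᵥ x t < y + ε := by
  by_cases hgap : ∃ b ∈ X, ∀ y ∈ weightedArgmin X h A, y + ε ≤ b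
  · obtain ⟨b, hb, hYb⟩ := hgap
    set s := sSup (weightedArgmin X h A)
    have hle : ∀ y ∈ weightedArgmin X h A, y ≤ s := fun y hy =>
      le_csSup ⟨b, fun y hy => by linarith [hYb y hy]⟩ hy
    have hsb : s ≤ b - ε := csSup_le hne fun y hy => by linarith [hYb y hy]
    obtain ⟨y, hy, hsy⟩ := exists_lt_of_lt_csSup hne (show s - ε / 3 < s by linarith)
    have hmem : s + ε / 3 ∈ X :=
      hx.convex.ordConnected.out (weightedArgmin_subset hy) hb
        ⟨by linarith [hle y hy], by linarith⟩
    obtain ⟨c, hc, hgrad⟩ := exists_pos_le_sum_of_forall_weightedArgmin_lt hx.subgradient hA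
      hconn hcomp hne hmem fun y hy => by linarith [hle y hy]
    filter_upwards [hx.eventually_dotProduct_lt hp hcons hmem hc (show 0 < ε / 3 by linarith)
      fun t => hgrad _ (hpA t)] with t ht
    exact ⟨y, hy, by linarith⟩
  · push Not at hgap
    exact .of_forall fun t =>
      hgap _ (dotProduct_mem_of_convex hx.convex (hp.mem_stdSimplex t) (hx.mem t))

lemma eventually_exists_mem_weightedArgmin_gt {ε : ℝ} (hε : 0 < ε) :
    ∀ᶠ t in atTop, ∃ y ∈ weightedArgmin X h A, y - ε < p t ⬝ᵥ x t := by
  have hneg := hx.neg.eventually_exists_mem_weightedArgmin_lt hp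
    (fun i j => by simpa only [Pi.neg_apply, neg_sub_neg] using hcons j i) hA hcomp hconn
    (by simpa only [weightedArgmin_neg, Set.nonempty_neg] using hne) hpA hε
  filter_upwards [hneg] with t ⟨y, hy, hlt⟩
  rw [weightedArgmin_neg] at hy
  rw [Pi.neg_apply, dotProduct_neg] at hlt
  exact ⟨-y, hy, by linarith⟩

end Average

end IsSubgradientMethod

lemma infDist_lt_of_ordConnected {Y : Set ℝ} (hY : Y.OrdConnected) {y z u ε : ℝ} (hε : 0 < ε)
    (hy : y ∈ Y) (hz : z ∈ Y) (hyu : y - ε < u) (huz : u < z + ε) : Metric.infDist u Y < ε := by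
  obtain ⟨v, hv, huv⟩ : ∃ v ∈ Y, |u - v| < ε := by
    rcases lt_or_ge u y with huy | hyu'
    · exact ⟨y, hy, abs_lt.2 ⟨by linarith, by linarith⟩⟩
    rcases lt_or_ge z u with hzu | huz'
    · exact ⟨z, hz, abs_lt.2 ⟨by linarith, by linarith⟩⟩
    · exact ⟨u, hY.out hy hz ⟨hyu', huz'⟩, by simpa using hε⟩
  exact (Metric.infDist_le_dist_of_mem hv).trans_lt huv

lemma IsSubgradientMethod.tendsto_infDist {X : Set ℝ} {L : ℝ} {h g : W → ℝ → ℝ}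
    {M : ℕ → Matrix W W ℝ} {lam : ℕ → ℝ} {x : ℕ → W → ℝ}
    (hx : IsSubgradientMethod X L h g M lam x) {p : ℕ → W → ℝ} (hp : IsAbsoluteProbability M p)
    (hcons : ∀ i j, Tendsto (fun t => |x t i - x t j|) atTop (𝓝 0)) {A : Set (W → ℝ)}
    (hA : ∀ α ∈ A, 0 ≤ α) (hcomp : IsCompact A) (hconn : IsPreconnected A)
    (hne : (weightedArgmin X h A).Nonempty) (hpA : ∀ t, p t ∈ A) (i : W) :
    Tendsto (fun t => Metric.infDist (x t i) (weightedArgmin X h A)) atTop (𝓝 0) := by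
  rw [Metric.tendsto_nhds]
  intro ε hε
  have hε2 : 0 < ε / 2 := half_pos hε
  filter_upwards [hx.eventually_exists_mem_weightedArgmin_lt hp hcons hA hcomp hconn hne hpA hε2,
    hx.eventually_exists_mem_weightedArgmin_gt hp hcons hA hcomp hconn hne hpA hε2,
    eventually_forall_abs_sub_dotProduct_le hp.mem_stdSimplex hcons hε2]
    with t ⟨z, hz, hlt⟩ ⟨y, hy, hgt⟩ hnear
  rw [Real.dist_0_eq_abs, abs_of_nonneg Metric.infDist_nonneg]
  calc Metric.infDist (x t i) (weightedArgmin X h A)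
      ≤ Metric.infDist (p t ⬝ᵥ x t) (weightedArgmin X h A) + dist (x t i) (p t ⬝ᵥ x t) :=
        Metric.infDist_le_infDist_add_dist
    _ < ε / 2 + ε / 2 := add_lt_add_of_lt_of_le (infDist_lt_of_ordConnected
        (ordConnected_weightedArgmin hx.subgradient hA hconn hx.convex) hε2 hy hz hgt hlt)
        (hnear i)
    _ = ε := add_halves ε

end SubgradientMethod

section ConvergenceOverGraphs

variable {W : Type*} [Fintype W] [DecidableEq W] [Nonempty W] {a κ : ℝ} {T : Set (Digraph W)}
  {Hs : ℕ → Digraph W} {M : ℕ → Matrix W W ℝ} (hM : ∀ t, IsAveraging a κ (Hs t) (M t))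
  (hT : ∀ t, Hs t ∈ T)

include hM hT

lemma exists_isAbsoluteProbability_mem_validWeights (ha : 0 ≤ a) (hκ : 0 ≤ κ) (hκ1 : κ ≤ 1)
    {β : ℝ} {γ : ℕ} (hγ : ∀ H ∈ T, γ ≤ (sourceComponent H).ncard)
    (hβ : β ≤ a ^ (T.ncard * Fintype.card W) * κ ^ Fintype.card W) :
    ∃ p, IsAbsoluteProbability M p ∧ ∀ t, p t ∈ validWeights W β γ := by
  obtain ⟨p, hp⟩ := exists_isAbsoluteProbability fun t => (hM t).stochastic
  refine ⟨p, hp, fun t => ⟨hp.mem_stdSimplex t, ?_⟩⟩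
  obtain ⟨H, hH, hlarge⟩ :=
    exists_forall_mem_sourceComponent_le_stepProduct hM ha hκ hκ1 hT t
  exact (hγ H hH).trans (Set.ncard_le_ncard
    (fun j hj => hβ.trans (hp.le_apply (hlarge j hj))) (Set.toFinite _))

variable {X : Set ℝ} {L : ℝ} {h g : W → ℝ → ℝ} {lam : ℕ → ℝ} {x : ℕ → W → ℝ}

lemma IsSubgradientMethod.tendsto_abs_sub_of_isAveraging
    (hx : IsSubgradientMethod X L h g M lam x) (ha : 0 < a) (hκ : 0 < κ) (hκ1 : κ ≤ 1)
    (hsource : ∀ H ∈ T, (sourceComponent H).Nonempty) (i k : W) :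
    Tendsto (fun t => |x t i - x t k|) atTop (𝓝 0) := by
  have hν : T.ncard * Fintype.card W ≠ 0 :=
    mul_ne_zero (Set.ncard_ne_zero_of_mem (hT 0) T.toFinite) Fintype.card_ne_zero
  refine hx.tendsto_abs_sub hν
    (mul_pos (pow_pos ha (T.ncard * Fintype.card W)) (pow_pos hκ (Fintype.card W)))
    (fun t => ?_) i k
  obtain ⟨H, hH, hlarge⟩ :=
    exists_forall_mem_sourceComponent_le_stepProduct hM ha.le hκ.le hκ1 hT t
  obtain ⟨j, hj⟩ := hsource H hH
  exact ⟨j, hlarge j hj⟩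

lemma IsSubgradientMethod.convergence_of_isAveraging
    (hx : IsSubgradientMethod X L h g M lam x) (hmin : ∀ i, (argminOn X (h i)).Nonempty)
    (ha : 0 < a) (hκ : 0 < κ) (hκ1 : κ ≤ 1) (hsource : ∀ H ∈ T, (sourceComponent H).Nonempty)
    {β : ℝ} {γ : ℕ} (hγ : ∀ H ∈ T, γ ≤ (sourceComponent H).ncard)
    (hβ : β ≤ a ^ (T.ncard * Fintype.card W) * κ ^ Fintype.card W)
    (hβcard : β ≤ (Fintype.card W : ℝ)⁻¹) :
    (weightedArgmin X h (validWeights W β γ)).Nonempty ∧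
      (∀ i, Tendsto (fun t => Metric.infDist (x t i) (weightedArgmin X h (validWeights W β γ)))
        atTop (𝓝 0)) ∧
      ∀ i k, Tendsto (fun t => |x t i - x t k|) atTop (𝓝 0) := by
  have hγcard : γ ≤ Fintype.card W :=
    (hγ _ (hT 0)).trans ((Set.ncard_le_card _).trans_eq Nat.card_eq_fintype_card)
  have hnonneg : ∀ α ∈ validWeights W β γ, 0 ≤ α := fun α hα => hα.1.1
  have hne := weightedArgmin_nonempty hx.convex hx.subgradient hmin hnonneg
    ⟨_, uniform_mem_validWeights hγcard hβcard⟩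
  have hcons := hx.tendsto_abs_sub_of_isAveraging hM hT ha hκ hκ1 hsource
  obtain ⟨p, hp, hpmem⟩ :=
    exists_isAbsoluteProbability_mem_validWeights hM hT ha.le hκ.le hκ1 hγ hβ
  exact ⟨hne, hx.tendsto_infDist hp hcons hnonneg (isCompact_validWeights β γ)
    (isPreconnected_validWeights hγcard hβcard) hne hpmem, hcons⟩

end ConvergenceOverGraphs

section AveragingMatrix

variable {W R : Type*} [Fintype W] [DecidableEq W] [Field R]

/-- The matrix of the weighted means in which the value of `i` itself has the additional weight `1`
and that of `j` the weight `B i j`, before normalization. -/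
def averagingMatrix (B : Matrix W W R) : Matrix W W R :=
  fun i j => (1 + ∑ l, B i l)⁻¹ * ((1 : Matrix W W R) i j + B i j)

lemma averagingMatrix_mulVec (B : Matrix W W R) (y : W → R) (i : W) :
    (averagingMatrix B *ᵥ y) i = (1 + ∑ l, B i l)⁻¹ * (y i + (B *ᵥ y) i) := by
  have hrow : averagingMatrix B i = (1 + ∑ l, B i l)⁻¹ • (1 + B : Matrix W W R) i := rfl
  rw [Matrix.mulVec, hrow, smul_dotProduct, smul_eq_mul]
  congr 1
  exact congrFun (by rw [Matrix.add_mulVec, Matrix.one_mulVec] : (1 + B) *ᵥ y = y + B *ᵥ y) i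

lemma isAveraging_averagingMatrix [LinearOrder R] [IsStrictOrderedRing R] {B : Matrix W W R}
    (hB : ∀ i j, 0 ≤ B i j) {a κ : R} (ha : 0 ≤ a) (hdiag : ∀ i, a ≤ (1 + ∑ l, B i l)⁻¹)
    {H : Digraph W} (hedge : ∀ i j, H.Adj j i → κ ≤ B i j) :
    IsAveraging a κ H (averagingMatrix B) := by
  have hpos : ∀ i, 0 < 1 + ∑ l, B i l := fun i =>
    add_pos_of_pos_of_nonneg one_pos (Finset.sum_nonneg fun l _ => hB i l)
  have hone : ∀ i j, (0 : R) ≤ (1 : Matrix W W R) i j := fun i j => by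
    rw [Matrix.one_apply]
    split_ifs <;> simp
  refine ⟨mem_rowStochastic.2 ⟨fun i j => ?_, ?_⟩, fun i => ?_, fun i j hij => ?_⟩
  · exact mul_nonneg (inv_nonneg.2 (hpos i).le) (add_nonneg (hone i j) (hB i j))
  · ext i
    rw [averagingMatrix_mulVec]
    simpa [Matrix.mulVec, dotProduct] using inv_mul_cancel₀ (hpos i).ne'
  · refine (hdiag i).trans (le_mul_of_one_le_right (inv_nonneg.2 (hpos i).le) ?_)
    simpa using hB i i
  · calc a * κ ≤ a * B i j := mul_le_mul_of_nonneg_left (hedge i j hij) ha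
      _ ≤ (1 + ∑ l, B i l)⁻¹ * ((1 : Matrix W W R) i j + B i j) :=
        mul_le_mul (hdiag i) (le_add_of_nonneg_left (hone i j)) (hB i j)
          (inv_nonneg.2 (hpos i).le)

end AveragingMatrix

section Sequences

lemma tendsto_zero_of_summable_sq {u : ℕ → ℝ} (hu : Summable fun t => u t ^ 2) :
    Tendsto u atTop (𝓝 0) :=
  (tendsto_zero_iff_abs_tendsto_zero u).2
    (by simpa [Function.comp_def, Real.sqrt_sq_eq_abs] using hu.tendsto_atTop_zero.sqrt)

lemma tendsto_sum_range_succ_atTop {u : ℕ → ℝ}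
    (hu : Tendsto (fun T => ∑ t ∈ Finset.range T, u t) atTop atTop) :
    Tendsto (fun T => ∑ t ∈ Finset.range T, u (t + 1)) atTop atTop := by
  refine ((tendsto_atTop_add_const_right atTop (-u 0) hu).comp (tendsto_add_atTop_nat 1)).congr
    fun T => ?_
  simp [Finset.sum_range_succ']

end Sequences

section WeightBound

variable {d : ℝ} {τ m : ℕ}

lemma one_div_two_mul_pow_le_mul {f : ℕ} (hd : 0 < d) (hf : f < τ) :
    1 / (2 * d) ^ (τ * m) ≤ d⁻¹ ^ (τ * m) * ((1 / 2) ^ (f + 1)) ^ m :=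
  calc 1 / (2 * d) ^ (τ * m) = d⁻¹ ^ (τ * m) * (1 / 2) ^ (τ * m) := by
        rw [← mul_pow, ← _root_.one_div_pow, ← one_div, mul_comm (1 / d), one_div_mul_one_div]
    _ ≤ d⁻¹ ^ (τ * m) * (1 / 2) ^ ((f + 1) * m) :=
        mul_le_mul_of_nonneg_left (pow_le_pow_of_le_one (by norm_num) (by norm_num)
          (Nat.mul_le_mul_right m hf)) (by positivity)
    _ = d⁻¹ ^ (τ * m) * ((1 / 2) ^ (f + 1)) ^ m := by rw [← pow_mul (1 / 2) (f + 1)]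

lemma one_div_two_mul_pow_le_inv (hd : 1 ≤ d) (hτ : 0 < τ) (hm : 0 < m) :
    1 / (2 * d) ^ (τ * m) ≤ (m : ℝ)⁻¹ := by
  rw [one_div]
  refine inv_anti₀ (by exact_mod_cast hm) ?_
  calc (m : ℝ) ≤ 2 ^ m := by exact_mod_cast Nat.lt_two_pow_self.le
    _ ≤ 2 ^ (τ * m) := pow_le_pow_right₀ one_le_two (Nat.le_mul_of_pos_left m hτ)
    _ ≤ (2 * d) ^ (τ * m) := pow_le_pow_left₀ zero_le_two (le_mul_of_one_le_right zero_le_two hd) _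

end WeightBound

section Execution

variable {V : Type*} [Fintype V] [DecidableEq V]

lemma sum_subtype_notMem {R : Type*} [AddCommMonoid R] (F : Finset V) (u : V → R) :
    ∑ i : {v : V // v ∉ F}, u i = ∑ i ∈ Fᶜ, u i :=
  (Finset.sum_subtype Fᶜ (fun _ => Finset.mem_compl) u).symm

lemma sum_subtype_notMem_ite_mem {R : Type*} [AddCommMonoid R] (F N : Finset V) (u : V → R) :
    ∑ i : {v : V // v ∉ F}, (if (i : V) ∈ N then u i else 0) = ∑ i ∈ N \ F, u i := by
  rw [sum_subtype_notMem F fun i => if i ∈ N then u i else 0, Finset.sum_ite_mem,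
    Finset.inter_comm, ← Finset.sdiff_eq_inter_compl]

lemma mem_validWeights_subtype_notMem {F : Finset V} {α : V → ℝ} {β : ℝ} {γ : ℕ} :
    (fun i : {v : V // v ∉ F} => α i) ∈ validWeights {v : V // v ∉ F} β γ ↔
      (∀ i ∈ Fᶜ, 0 ≤ α i) ∧ ∑ i ∈ Fᶜ, α i = 1 ∧ γ ≤ {i : V | i ∈ Fᶜ ∧ β ≤ α i}.ncard := by
  have hncard : {i : {v : V // v ∉ F} | β ≤ α i}.ncard = {i : V | i ∈ Fᶜ ∧ β ≤ α i}.ncard := by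
    rw [← Set.ncard_image_of_injective _ Subtype.val_injective]
    congr 1
    ext i
    simp [and_comm]
  simp only [validWeights, stdSimplex, Set.mem_ofPred_eq, sum_subtype_notMem, hncard, and_assoc,
    Subtype.forall, Finset.mem_compl]

lemma weightedArgmin_validWeights_eq_optimalSet (F : Finset V) (h : V → ℝ → ℝ) (X : Set ℝ) (β : ℝ)
    (γ : ℕ) :
    weightedArgmin X (fun i : {v : V // v ∉ F} => h i) (validWeights {v : V // v ∉ F} β γ) =
      optimalSet F h X β γ := by
  have hsum : ∀ α : V → ℝ, (fun y => ∑ i : {v : V // v ∉ F}, α i * h i y) =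
      fun y => ∑ i ∈ Fᶜ, α i * h i y := fun α =>
    funext fun y => sum_subtype_notMem F fun i => α i * h i y
  ext y
  simp only [weightedArgmin, optimalSet, validFunctions, Set.mem_iUnion, Set.mem_ofPred_eq,
    exists_prop]
  rw [Subtype.val_injective.surjective_comp_right.exists]
  simp only [Function.comp_def, mem_validWeights_subtype_notMem, hsum]
  constructor
  · rintro ⟨α, ⟨hα, hα1, hγ⟩, hy⟩
    exact ⟨_, ⟨α, hα, hα1, hγ, rfl⟩, hy⟩
  · rintro ⟨_, ⟨α, hα, hα1, hγ, rfl⟩, hy⟩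
    exact ⟨α, ⟨hα, hα1, hγ⟩, hy⟩

variable {G : Digraph V} {f : ℕ} {F : Finset V} {X : Set ℝ} {h' : V → ℝ → ℝ} {stepsize : ℕ → ℝ}
  {x : ℕ → V → ℝ} {w : ℕ → V → V → ℝ}

namespace IsExecution

lemma two_mul_le_inDegree (hexec : IsExecution G f F X h' stepsize x w) {i : V} (hi : i ∉ F) :
    2 * f ≤ inDegree G i := by
  obtain ⟨K, hK, -⟩ := hexec.update 0 i hi
  exact (Nat.le_add_left _ _).trans_eq hK.card_add

lemma one_le_maxInDegree_add_one_sub (hexec : IsExecution G f F X h' stepsize x w) {i : V}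
    (hi : i ∉ F) : 1 ≤ (maxInDegree G : ℝ) + 1 - 2 * f := by
  have hdeg : 2 * f ≤ maxInDegree G :=
    (hexec.two_mul_le_inDegree hi).trans (Finset.le_sup (Finset.mem_univ i))
  have hdeg' : (2 * f : ℝ) ≤ maxInDegree G := by exact_mod_cast hdeg
  linarith

lemma lt_numReducedGraphs (hexec : IsExecution G f F X h' stepsize x w) (hF : F.card ≤ f) {i : V}
    (hi : i ∉ F) : f < numReducedGraphs G f F := by
  refine Nat.lt_two_pow_self.trans_le (two_pow_le_numReducedGraphs hi ?_)
  have hdeg : 2 * f ≤ (inNbrs G i).card := hexec.two_mul_le_inDegree hi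
  have hdiff := Finset.le_card_sdiff F (inNbrs G i)
  omega

lemma exists_weights (hexec : IsExecution G f F X h' stepsize x w) (hF : F.card ≤ f)
    (hdeg : 0 < f → ∀ i, inDegree G i ≠ 2 * f) (t : ℕ) (i : {v : V // v ∉ F}) :
    ∃ b : {v : V // v ∉ F} → ℝ, ∃ E : Finset V, (∀ j, 0 ≤ b j) ∧ E.card ≤ f ∧
      (∀ j : {v : V // v ∉ F}, G.Adj j i → (j : V) ∉ E → (1 / 2) ^ (f + 1) ≤ b j) ∧
      1 + ∑ j, b j = (inDegree G i : ℝ) + 1 - 2 * f ∧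
      IsProjection X ((1 + ∑ j, b j)⁻¹ * (x t i + ∑ j, b j * x t j) - stepsize t * h' i (x t i))
        (x (t + 1) i) := by
  obtain ⟨K, hK, hproj⟩ := hexec.update t i i.2
  have hcard : K.card + 2 * f = inDegree G i := hK.card_add
  obtain ⟨c, hc⟩ := hK.exists_isHonestWeighting hF fun hf =>
    Finset.card_pos.1 (by have := hdeg hf i; omega)
  obtain ⟨E, hE, hlarge⟩ := hc.exists_large
  let b : {v : V // v ∉ F} → ℝ := fun j => if (j : V) ∈ inNbrs G i then c j else 0
  have hb1 : 1 + ∑ j, b j = (inDegree G i : ℝ) + 1 - 2 * f := by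
    rw [sum_subtype_notMem_ite_mem, hc.sum_eq, ← hcard]
    push_cast
    ring
  have hbx : ∑ j, b j * x t j = ∑ j ∈ K, w t j i := by
    simp only [b, ite_mul, zero_mul]
    rw [sum_subtype_notMem_ite_mem F (inNbrs G i) fun j => c j * x t j, ← hc.sum_mul_eq]
    refine Finset.sum_congr rfl fun j hj => ?_
    obtain ⟨hjN, hjF⟩ := Finset.mem_sdiff.1 hj
    rw [hexec.honest t j hjF i i.2 (mem_inNbrs.1 hjN)]
  refine ⟨b, E, fun j => ?_, hE, fun j hadj hjE => ?_, hb1, ?_⟩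
  · simp only [b]
    split_ifs
    exacts [hc.nonneg j, le_rfl]
  · have hjN : (j : V) ∈ inNbrs G i := mem_inNbrs.2 hadj
    simpa only [b, if_pos hjN] using hlarge j (Finset.mem_sdiff.2 ⟨hjN, j.2⟩) hjE
  · rwa [hb1, hbx, ← one_div]

lemma exists_isAveraging (hexec : IsExecution G f F X h' stepsize x w) (hF : F.card ≤ f)
    (hdeg : 0 < f → ∀ i, inDegree G i ≠ 2 * f) (hd : 0 < (maxInDegree G : ℝ) + 1 - 2 * f) (t : ℕ) :
    ∃ M H, IsAveraging ((maxInDegree G : ℝ) + 1 - 2 * f)⁻¹ ((1 / 2) ^ (f + 1)) H M ∧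
      IsReducedGraph G f F H ∧ ∀ i : {v : V // v ∉ F}, IsProjection X
        ((M *ᵥ fun j => x t j) i - stepsize t * h' i (x t i)) (x (t + 1) i) := by
  choose b E hb hE hlarge hbsum hproj using hexec.exists_weights hF hdeg t
  have hpos : ∀ i, 0 < 1 + ∑ j, b i j := fun i =>
    add_pos_of_pos_of_nonneg one_pos (Finset.sum_nonneg fun j _ => hb i j)
  have hle : ∀ i, 1 + ∑ j, b i j ≤ (maxInDegree G : ℝ) + 1 - 2 * f := fun i => by
    have hmax : (inDegree G i : ℝ) ≤ maxInDegree G := by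
      exact_mod_cast Finset.le_sup (f := inDegree G) (Finset.mem_univ (i : V))
    linarith [hbsum i]
  refine ⟨averagingMatrix (Matrix.of b), removeIncoming G F E,
    isAveraging_averagingMatrix hb (inv_nonneg.2 hd.le) (fun i => inv_anti₀ (hpos i) (hle i))
      fun i j hij => hlarge i j hij.1 hij.2,
    isReducedGraph_removeIncoming G F hE, fun i => ?_⟩
  rw [averagingMatrix_mulVec]
  exact hproj i

lemma exists_isSubgradientMethod (hexec : IsExecution G f F X h' stepsize x w) (hF : F.card ≤ f)
    (hdeg : 0 < f → ∀ i, inDegree G i ≠ 2 * f) (hd : 0 < (maxInDegree G : ℝ) + 1 - 2 * f)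
    (hX : Convex ℝ X) {L : ℝ} {h : V → ℝ → ℝ} (hsub : ∀ i ∉ F, IsSubgradientOn X (h i) (h' i))
    (hbdd : ∀ i ∉ F, ∀ y ∈ X, |h' i y| ≤ L) (hpos : ∀ t, 0 ≤ stepsize t)
    (hlim : Tendsto stepsize atTop (𝓝 0))
    (hsum : Tendsto (fun T => ∑ t ∈ Finset.range T, stepsize t) atTop atTop) :
    ∃ (Hs : ℕ → Digraph {v : V // v ∉ F}) (M : ℕ → Matrix {v : V // v ∉ F} {v : V // v ∉ F} ℝ),
      (∀ t, IsReducedGraph G f F (Hs t)) ∧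
      (∀ t, IsAveraging ((maxInDegree G : ℝ) + 1 - 2 * f)⁻¹ ((1 / 2) ^ (f + 1)) (Hs t) (M t)) ∧
      IsSubgradientMethod X L (fun i : {v : V // v ∉ F} => h i) (fun i => h' i) M
        (fun t => stepsize (t + 1)) fun t i => x (t + 1) i := by
  choose M Hs hM hHs hproj using hexec.exists_isAveraging hF hdeg hd
  exact ⟨fun t => Hs (t + 1), fun t => M (t + 1), fun t => hHs _, fun t => hM _,
    { convex := hX
      subgradient := fun i => hsub i i.2
      bounded := fun i => hbdd i i.2
      stochastic := fun t => (hM _).stochastic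
      step_nonneg := fun t => hpos _
      step_tendsto := hlim.comp (tendsto_add_atTop_nat 1)
      step_sum := tendsto_sum_range_succ_atTop hsum
      mem := fun t i => (hproj t i).1
      update := fun t => hproj (t + 1) }⟩

end IsExecution

end Execution

end ByzOpt

open ByzOpt in
theorem mainTheorem1_general {V : Type*} [Fintype V] [DecidableEq V]
    (G : Digraph V) (hloop : ∀ v, ¬ G.Adj v v) (f : ℕ) (F : Finset V) (hF : F.card ≤ f)
    (hG : ∀ F' : Finset V, F'.card ≤ f → ∀ H, IsReducedGraph G f F' H →
      (sourceComponent H).Nonempty)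
    (γ : ℕ) (hsource : ∀ H, IsReducedGraph G f F H → γ ≤ (sourceComponent H).ncard) (β : ℝ)
    (hβ : β ≤ 1 / (2 * ((maxInDegree G : ℝ) + 1 - 2 * f)) ^
      (numReducedGraphs G f F * (Fintype.card V - F.card)))
    (X : Set ℝ) (hX : Convex ℝ X) (L : ℝ) (h h' : V → ℝ → ℝ)
    (hsub : ∀ i ∉ F, IsSubgradientOn X (h i) (h' i))
    (hbdd : ∀ i ∉ F, ∀ y ∈ X, |h' i y| ≤ L)
    (hmin : ∀ i ∉ F, (argminOn X (h i)).Nonempty)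
    (stepsize : ℕ → ℝ) (hpos : ∀ t, 0 ≤ stepsize t) (hlim : Tendsto stepsize atTop (𝓝 0))
    (hsum : Tendsto (fun T => ∑ t ∈ Finset.range T, stepsize t) atTop atTop)
    (x : ℕ → V → ℝ) (w : ℕ → V → V → ℝ)
    (hexec : IsExecution G f F X h' stepsize x w) :
    (optimalSet F h X β γ).Nonempty ∧
      (∀ i ∉ F, Tendsto (fun t => Metric.infDist (x t i) (optimalSet F h X β γ)) atTop (𝓝 0)) ∧
      ∀ i ∉ F, ∀ j ∉ F, Tendsto (fun t => |x t i - x t j|) atTop (𝓝 0) := by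
  have hdeg : 0 < f → ∀ i, inDegree G i ≠ 2 * f := fun hf => inDegree_ne_two_mul hloop hf hG
  obtain ⟨i₀, -⟩ := hG F hF _ (isReducedGraph_removeIncoming G F (R := fun _ => ∅) (by simp))
  have : Nonempty {v : V // v ∉ F} := ⟨i₀⟩
  have hd := hexec.one_le_maxInDegree_add_one_sub i₀.2
  have hd0 := one_pos.trans_le hd
  have hτ := hexec.lt_numReducedGraphs hF i₀.2
  obtain ⟨Hs, M, hHs, hM, hx⟩ :=
    hexec.exists_isSubgradientMethod hF hdeg hd0 hX hsub hbdd hpos hlim hsum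
  have hm : Fintype.card V - F.card = Fintype.card {v : V // v ∉ F} := by
    rw [Fintype.card_subtype_compl, Fintype.card_coe]
  rw [hm] at hβ
  have hconv := hx.convergence_of_isAveraging hM hHs
    (fun i => hmin i i.2) (inv_pos.2 hd0) (by positivity) (pow_le_one₀ (by norm_num) (by norm_num))
    (hG F hF) hsource (hβ.trans (one_div_two_mul_pow_le_mul hd0 hτ))
    (hβ.trans (one_div_two_mul_pow_le_inv hd (Nat.zero_lt_of_lt hτ) Fintype.card_pos))
  rw [weightedArgmin_validWeights_eq_optimalSet] at hconv
  exact ⟨hconv.1, fun i hi => (tendsto_add_atTop_iff_nat 1).1 (hconv.2.1 ⟨i, hi⟩),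
    fun i hi j hj => (tendsto_add_atTop_iff_nat (f := fun t => |x t i - x t j|) 1).1
      (hconv.2.2 ⟨i, hi⟩ ⟨j, hj⟩)⟩

theorem mainTheorem1 {V : Type*} [Fintype V] [DecidableEq V]
    -- the network, without self-loops, and the set of faulty agents
    (G : Digraph V) (hloop : ∀ v, ¬ G.Adj v v)
    (f : ℕ) (F : Finset V) (hF : F.card ≤ f)
    -- standing assumption: whichever agents are faulty, every reduced graph has a source component
    (hG : ∀ F' : Finset V, F'.card ≤ f → ∀ H, ByzOpt.IsReducedGraph G f F' H →
      (ByzOpt.sourceComponent H).Nonempty)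
    (γ : ℕ) (hγ : f + 1 ≤ γ)
    (hsource : ∀ H, ByzOpt.IsReducedGraph G f F H → γ ≤ (ByzOpt.sourceComponent H).ncard)
    (β : ℝ)
    (hβ : β ≤ 1 / (2 * ((ByzOpt.maxInDegree G : ℝ) + 1 - 2 * f)) ^
      (ByzOpt.numReducedGraphs G f F * (Fintype.card V - F.card)))
    -- the constraint set and the cost functions
    (X : Set ℝ) (hXne : X.Nonempty) (hXclosed : IsClosed X) (hXconvex : Convex ℝ X)
    (L : ℝ) (h h' : V → ℝ → ℝ) (hadm : ∀ i, ByzOpt.Admissible X L (h i) (h' i))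
    -- the stepsizes
    (stepsize : ℕ → ℝ) (hmono : Antitone stepsize)
    (hsum : Tendsto (fun T => ∑ t ∈ Finset.range T, stepsize t) atTop atTop)
    (hsq : Summable fun t => stepsize t ^ 2)
    -- an arbitrary execution
    (x : ℕ → V → ℝ) (w : ℕ → V → V → ℝ)
    (hexec : ByzOpt.IsExecution G f F X h' stepsize x w) :
    (ByzOpt.optimalSet F h X β γ).Nonempty ∧
      (∀ i ∉ F, Tendsto (fun t => Metric.infDist (x t i) (ByzOpt.optimalSet F h X β γ))
        atTop (𝓝 0)) ∧
      (∀ i ∉ F, ∀ j ∉ F, Tendsto (fun t => |x t i - x t j|) atTop (𝓝 0)) := by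
  have hlim := ByzOpt.tendsto_zero_of_summable_sq hsq
  exact mainTheorem1_general G hloop f F hF hG γ hsource β hβ X hXconvex L h h'
    (fun i _ => (hadm i).isSubgradientOn) (fun i _ => (hadm i).bounded_gradient)
    (fun i _ => (hadm i).argmin_nonempty) stepsize (hmono.le_of_tendsto hlim) hlim hsum x w hexec
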